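/- **Machine.** A two-level memory: an unbounded slow memory and a fast memory holding at most $S$ numbers, $S\ge 3$. The matrix entries are initially in slow memory. An operation can be performed only when all entries it reads or overwrites are in fast memory. Loading one entry from slow to fast memory, or storing one entry back, is one I/O operation; evicting an entry from fast memory is free. **Algorithm.** Let $k=k(S)$ be the largest integer with $k(k+1)/2\le S$ and $t=t(S)$ the largest integer with $t^2+2t\le S$. The operations are those of the classical Cholesky factorization, $A_{kk}\leftarrow\sqrt{A_{kk}}$, $A_{ik}\leftarrow A_{ik}/A_{kk}$ and $A_{ij}\leftarrow A_{ij}-A_{ik}A_{jk}$, on the lower triangle, in place. The right-looking Large Block Cholesky algorithm $\mathrm{LBC}$ with block size $b=\lfloor\sqrt N\rfloor$ does the following for $i=0,1,\dots,\lfloor N/b\rfloor$, with $I_0=[ib,\min((i+1)b,N))$ and $I_1=[(i+1)b,N)$: factor $A[I_0,I_0]$ with OOC_CHOL; then, if $(i+1)b<N$, solve for $A[I_1,I_0]$ with OOC_TRSM, and update $A[I_1,I_1]\leftarrow A[I_1,I_1]-A[I_1,I_0]A[I_1,I_0]^{T}$ with TBS. (If $b\mid N$, the last pass is empty; otherwise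 the last block is smaller.) OOC_CHOL and OOC_TRSM, and OOC_SYRK below, are the one-tile, narrow-block out-of-core algorithms, left-looking in the case of OOC_CHOL and OOC_TRSM: a $t\times t$ tile of the result (smaller at the borders) is kept in fast memory while the columns needed to compute it are streamed through. TBS for an $n\times n$ matrix $C$ and an $n\times m$ matrix $A$: let $c$ be the largest integer $\le n/k$ coprime with all primes $\le k-2$. If $c<k-1$, use OOC_SYRK. Otherwise use OOC_SYRK for the last $n-ck$ rows of $C$, call TBS recursively for the $k$ diagonal $c\times c$ blocks of the first $ck$ rows, and for each $0\le i,j<c$ put $r_0=j$ and $r_u=uc+\big((i+j(u-1))\bmod c\big)$ for $1\le u<k$, load the entries $C_{r_u r_v}$ $(0\le v<u<k)$, and update them with one column of $A$ after the other, loading of each column only the entries in the rows $r_0,\dots,r_{k-1}$; then store them. **Theorem (LBC communication cost).** Let $S\ge 3$. 1. For every $N$ and every symmetric positive definite $A\in\mathbb R^{N\times N}$, LBC runs on $A$ with a fast memory of size $S$, never exceeding that size, and overwrites the lower triangle of $A$ by that of a lower triangular $L$ with $A=LL^{T}$. 2. There is a constant $C$, depending only on $S$, such that for every $N$ the number $Q_{\mathrm{LBC}}(N)$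 of I/O operations, loads and stores together, satisfies $$Q_{\mathrm{LBC}}(N)\le\frac{N^3}{3(k-1)}+C\,N^{5/2} \qquad\text{and}\qquad Q_{\mathrm{LBC}}(N)\le\frac1{3\sqrt2}\cdot\frac{N^3}{\sqrt S}\Big(1+\frac5{\sqrt S}\Big)+C\,N^{5/2}.$$ Since $k-1\sim\sqrt{2S}$, the coefficient of $N^3$ agrees, up to the factor $1+O(1/\sqrt S)$, with the coefficient $\frac1{3\sqrt2\sqrt S}$ of the lower bound for the Cholesky factorization. -/

import Mathlib

namespace OutOfCore

/-! ### The two-level memory machine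

One real number per cell; the cell `(i, j)` holds the entry in row `i` and column `j` of the matrix
that is factored in place (rows and columns are numbered from `0`). -/

/-- Addresses of the matrix entries. -/
abbrev Cell : Type := ℕ × ℕ

/-- The elementary operations of the classical Cholesky factorization. -/
inductive Op : Type
  /-- `A k k := √(A k k)` -/
  | root (k : ℕ) : Op
  /-- `A i k := A i k / A k k` -/
  | quot (i k : ℕ) : Op
  /-- `A i j := A i j - A i k * A j k` -/
  | update (i j k : ℕ) : Op

/-- The entries that an operation reads; all of them have to be in fast memory. -/
def Op.operands : Op → Finset Cell
  | .root k => {(k, k)}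
  | .quot i k => {(i, k), (k, k)}
  | .update i j k => {(i, j), (i, k), (j, k)}

/-- The entry that an operation overwrites. It is one of the operands. -/
def Op.target : Op → Cell
  | .root k => (k, k)
  | .quot i k => (i, k)
  | .update i j _ => (i, j)

/-- The value that an operation computes from the values `x` in fast memory. -/
noncomputable def Op.result (x : Cell → ℝ) : Op → ℝ
  | .root k => √(x (k, k))
  | .quot i k => x (i, k) / x (k, k)
  | .update i j k => x (i, j) - x (i, k) * x (j, k)

/-- Instructions: `load` copies an entry from slow to fast memory, `store` copies it back from fast
to slow memory, `evict` frees its place in fast memory, `compute` performs an operation. -/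
inductive Instr : Type
  | load (c : Cell) : Instr
  | store (c : Cell) : Instr
  | evict (c : Cell) : Instr
  | compute (o : Op) : Instr

/-- A schedule: a finite sequence of instructions. -/
abbrev Program : Type := List Instr

/-- State of the machine: the contents of the slow memory, the set of entries that are present in
fast memory, and their values there (`cache c` is meaningful only for `c ∈ resident`). -/
structure Memory : Type where
  slow : Cell → ℝ
  resident : Finset Cell
  cache : Cell → ℝ

/-- Execution of one instruction with a fast memory of size `S`; `none` if it is not allowed, that
is, if a load would exceed the size `S`, or if an entry that is used is not in fast memory. -/
noncomputable def step (S : ℕ) (m : Memory) : Instr → Option Memory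
  | .load c =>
      if (insert c m.resident).card ≤ S then
        some { m with
          resident := insert c m.resident
          cache := Function.update m.cache c (m.slow c) }
      else none
  | .store c =>
      if c ∈ m.resident then
        some { m with slow := Function.update m.slow c (m.cache c) }
      else none
  | .evict c =>
      if c ∈ m.resident then
        some { m with resident := m.resident.erase c }
      else none
  | .compute o =>
      if o.operands ⊆ m.resident then
        some { m with cache := Function.update m.cache o.target (o.result m.cache) }
      else none

/-- Execution of a program; `none` if some instruction is not allowed. -/
noncomputable def run (S : ℕ) : Program → Memory → Option Memory
  | [], m => some m
  | s :: p, m => (step S m s).bind (run S p)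

/-- Number of transfers caused by an instruction: one for a `load` or a `store`. -/
def Instr.transfers : Instr → ℕ
  | .load _ => 1
  | .store _ => 1
  | .evict _ => 0
  | .compute _ => 0

/-- Number of I/O operations of a program: all transfers between slow and fast memory, in both
directions. -/
def transfers (p : Program) : ℕ := (p.map Instr.transfers).sum

/-- The initial state: the matrix is in slow memory, the fast memory is empty. -/
def initial {N : ℕ} (A : Matrix (Fin N) (Fin N) ℝ) : Memory where
  slow := fun c => if h : c.1 < N ∧ c.2 < N then A ⟨c.1, h.1⟩ ⟨c.2, h.2⟩ else 0
  resident := ∅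
  cache := fun _ => 0

/-- The lower triangular `N × N` matrix that is stored in the lower triangle of the slow memory. -/
def lowerPart (N : ℕ) (m : Memory) : Matrix (Fin N) (Fin N) ℝ :=
  Matrix.of fun i j => if j ≤ i then m.slow (i, j) else 0

/-! ### Building blocks of the schedules -/

def loads (cs : List Cell) : Program := cs.map Instr.load

def evicts (cs : List Cell) : Program := cs.map Instr.evict

/-- Write the entries `cs` back to slow memory and remove them from fast memory. -/
def flush (cs : List Cell) : Program := cs.map Instr.store ++ evicts cs

/-- The integers `x` with `a ≤ x < b`, in increasing order. -/
def interval (a b : ℕ) : List ℕ := List.range' a (b - a)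

/-- The interval `a ≤ x < b` cut into consecutive intervals `(x, y)`, meaning `x ≤ · < y`, of length
`t`; the last one may be shorter. -/
def tiles (t a b : ℕ) : List (ℕ × ℕ) :=
  (List.range ((b - a + t - 1) / t)).map fun s => (a + s * t, min (a + (s + 1) * t) b)

/-- With the block `cells` of result entries in fast memory: for every column `k` in `cols`, load the
entries of column `k` in the rows `rows`, and use them to update every entry of the block. -/
def accumulate (cells : List Cell) (rows cols : List ℕ) : Program :=
  cols.flatMap fun k =>
    loads (rows.map fun r => (r, k)) ++
    (cells.map fun c => Instr.compute (.update c.1 c.2 k)) ++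
    evicts (rows.map fun r => (r, k))

/-- One block of an out-of-core symmetric update: load the block, update it with all columns in
`cols`, write it back. -/
def syrkBlock (cells : List Cell) (rows cols : List ℕ) : Program :=
  loads cells ++ accumulate cells rows cols ++ flush cells

/-- Side of the square tiles of the one-tile algorithms: the largest `t` with `t ^ 2 + 2 * t ≤ S`, so
that a `t × t` tile and two column pieces of length `t` fit in fast memory. -/
def tileSide (S : ℕ) : ℕ := Nat.sqrt (S + 1) - 1

/-- Side of the triangle blocks: the largest `k` with `k * (k + 1) / 2 ≤ S`, so that a triangle block
of side `k`, which has `k * (k - 1) / 2` entries, and a column piece of length `k` fit in fast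
memory. -/
def triangleSide (S : ℕ) : ℕ := Nat.findGreatest (fun k => k * (k + 1) / 2 ≤ S) S

/-! ### The symmetric rank-`k` update

Rows `r ≤ · < r + n` and columns in `cols` of the matrix play the part of `A`, the lower triangle of
the rows and columns `r ≤ · < r + n` plays the part of `C`, and `C` is replaced by `C - A * Aᵀ`. -/

/-- OOC_SYRK (one tile, narrow blocks), restricted to the rows `p ≤ · < r + n` of `C`. The whole `C`
is the case `p = r`. -/
def oocSyrk (S r p n : ℕ) (cols : List ℕ) : Program :=
  (tiles (tileSide S) p (r + n)).flatMap fun I =>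
    (tiles (tileSide S) r I.2).flatMap fun J =>
      syrkBlock
        (((interval I.1 I.2) ×ˢ (interval J.1 J.2)).filter fun c => c.2 ≤ c.1)
        ((interval J.1 J.2) ++ (interval I.1 I.2).filter fun x => J.2 ≤ x)
        cols

/-- The cyclic indexing family. -/
def cyclicIndex (c i j u : ℕ) : ℕ := if u = 0 then j else (i + j * (u - 1)) % c

/-- The row indices of the triangle block number `(i, j)` for zones of size `c`, counted from the
first row `r`, in increasing order. -/
def blockRow (r c i j u : ℕ) : ℕ := r + u * c + cyclicIndex c i j u

/-- The step of TBS that processes the triangle block number `(i, j)`. -/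
def triangleBlock (k r c i j : ℕ) (cols : List ℕ) : Program :=
  syrkBlock
    ((List.range k).flatMap fun u => (List.range u).map fun v =>
      (blockRow r c i j u, blockRow r c i j v))
    ((List.range k).map fun u => blockRow r c i j u)
    cols

/-- The largest integer `c ≤ n / k` that is coprime with all primes up to `k - 2`. -/
def zoneSize (k n : ℕ) : ℕ :=
  Nat.findGreatest (fun c => Nat.Coprime c (primorial (k - 2))) (n / k)

theorem zoneSize_lt {k n : ℕ} (h : ¬ (k < 2 ∨ zoneSize k n < k - 1)) : zoneSize k n < n := by
  have h1 : zoneSize k n ≤ n / k := Nat.findGreatest_le _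
  have h2 : 0 < n := by
    rcases Nat.eq_zero_or_pos n with h0 | h0
    · subst h0
      simp at h1
      omega
    · exact h0
  exact lt_of_le_of_lt h1 (Nat.div_lt_self h2 (by omega))

/-- TBS (Triangle Block SYRK). The test `k < 2` is only there for fast memories of size less than
`3`, in which no `update` with three distinct operands can be performed. -/
def tbs (S r n : ℕ) (cols : List ℕ) : Program :=
  let k := triangleSide S
  let c := zoneSize k n
  if _h : k < 2 ∨ c < k - 1 then oocSyrk S r r n cols
  else
    oocSyrk S r (r + c * k) n cols ++
    ((List.range k).flatMap fun i => tbs S (r + i * c) c cols) ++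
    (List.range c).flatMap fun i => (List.range c).flatMap fun j => triangleBlock k r c i j cols
termination_by n
decreasing_by exact zoneSize_lt _h

/-! ### Triangular solve and small Cholesky factorization -/

/-- The tile with rows `I` and columns `J` of a left-looking triangular solve whose first column is
`a`: update the tile with the columns `a ≤ · < J.1`, then divide by the triangle in rows and columns
`J`, which is read one column at a time. -/
def trsmTile (a : ℕ) (I J : ℕ × ℕ) : Program :=
  let rows := interval I.1 I.2
  let cells := rows ×ˢ interval J.1 J.2
  loads cells ++
  accumulate cells (rows ++ interval J.1 J.2) (interval a J.1) ++
  ((interval J.1 J.2).flatMap fun k =>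
    loads ((interval k J.2).map fun j => (j, k)) ++
    (rows.map fun i => Instr.compute (.quot i k)) ++
    ((rows ×ˢ interval (k + 1) J.2).map fun c => Instr.compute (.update c.1 c.2 k)) ++
    evicts ((interval k J.2).map fun j => (j, k))) ++
  flush cells

/-- OOC_TRSM (one tile, narrow blocks): with `L` the lower triangle in the rows and columns
`a ≤ · < a + n`, replace the rows `p ≤ · < q` of these columns, `B`, by the solution `X` of
`X * Lᵀ = B`. -/
def oocTrsm (S a n p q : ℕ) : Program :=
  (tiles (tileSide S) p q).flatMap fun I =>
    (tiles (tileSide S) a (a + n)).flatMap fun J => trsmTile a I J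

/-- The diagonal tile with rows and columns `J` of a left-looking Cholesky factorization whose first
column is `a`. -/
def cholTile (a : ℕ) (J : ℕ × ℕ) : Program :=
  let rows := interval J.1 J.2
  let cells := (rows ×ˢ rows).filter fun c => c.2 ≤ c.1
  loads cells ++
  accumulate cells rows (interval a J.1) ++
  (rows.flatMap fun k =>
    Instr.compute (.root k) ::
    (interval (k + 1) J.2).flatMap fun i =>
      Instr.compute (.quot i k) ::
      (interval (k + 1) (i + 1)).map fun j => Instr.compute (.update i j k)) ++
  flush cells

/-- OOC_CHOL (one tile, left-looking): Cholesky factorization, in place, of the lower triangle in the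
rows and columns `a ≤ · < a + n`. -/
def oocChol (S a n : ℕ) : Program :=
  (tiles (tileSide S) a (a + n)).flatMap fun J =>
    cholTile a J ++
    (tiles (tileSide S) J.2 (a + n)).flatMap fun I => trsmTile a I J

/-! ### Large Block Cholesky -/

/-- LBC, the right-looking Large Block Cholesky algorithm for an `N × N` matrix, with block size `b`
and a fast memory of size `S`. If `b` does not divide `N`, the last block is smaller; if it does, the
last pass of the loop does nothing. -/
def lbc (S N b : ℕ) : Program :=
  (List.range (N / b + 1)).flatMap fun i =>
    let lo := i * b
    let hi := min ((i + 1) * b) N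
    oocChol S lo (hi - lo) ++
    if hi < N then
      oocTrsm S lo (hi - lo) hi N ++
      tbs S hi (N - hi) (interval lo hi)
    else []

end OutOfCore

namespace OutOfCore

/-! ### Existence of the Cholesky factor -/

/-! Fix in advance the factor `L` with positive diagonal and `A = L * Lᵀ`. The operations with
target `(i, j)` use the columns `k = 0, …, j` in this order, so the state of a cell is one number:
how many of its operations are done. After `p ≤ j` of them the cell holds the tail of `∑ l, L i l *
L j l` over `p ≤ l ≤ j`, and after all of them `L i j` (`partialValue`). At the start this is the
entry of `A`, because `L` is lower triangular; an operation that is next in line and whose other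
operands are final leads to the next value (`Op.Ready.result_eq`). Correctness of a schedule thus
becomes bookkeeping of three things: progress, cells in fast memory, and slow copies that are out of
date. `Exec` is the corresponding Hoare triple, and the loop invariants are progress functions.

The combinatorial core is TBS: its triangle blocks must meet every pair of rows from different zones
exactly once. Two rows of a block determine its number because differences of zone numbers are
invertible modulo `c` (`cyclicIndex_injective`), and counting turns this injectivity into
surjectivity (`exists_cyclicIndex`).

For the cost, each column loaded for a triangle block brings `k` entries and serves `k (k - 1) / 2`
updates. With `m` columns, `m n² / (k - 1)` is reproduced exactly by the recursion when `n = c k`.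
Coprimality excludes only boundedly many rows, which cost `O(m n)` per call and `O(m n √n)` over the
recursion (`transfers_tbs_le`). A full pass of LBC that leaves `u` rows costs `b u² / (k - 1) +
O(N²)`; the main terms are dominated by a telescoping sum of cubes with total `N³ / 3`, and the
`O(√N)` error terms give `N^(5/2)` (`transfers_lbc_le`). The form in `√S` follows from the
maximality of `k` (`inv_triangleSide_le`). -/

theorem exists_cholesky {N : ℕ} {A : Matrix (Fin N) (Fin N) ℝ} (hA : A.PosDef) :
    ∃ L : Matrix (Fin N) (Fin N) ℝ,
      (∀ i j, i < j → L i j = 0) ∧ (∀ i, 0 < L i i) ∧ A = L * L.transpose := by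
  have htri : ∀ i j : Fin N, i < j → LDL.lower hA i j = 0 := by
    have h : (LDL.lowerInv hA).BlockTriangular OrderDual.toDual := fun i j hij =>
      LDL.lowerInv_triangular hA hij
    intro i j hij
    exact Matrix.blockTriangular_inv_of_blockTriangular h hij
  have hD : ∀ i, 0 ≤ LDL.diagEntries hA i := by
    intro i
    have h := (hA.posSemidef.mul_mul_conjTranspose_same (LDL.lowerInv hA)).diag_nonneg (i := i)
    rw [← LDL.diag_eq_lowerInv_conj] at h
    simpa [LDL.diag] using h
  have hM : ∃ M : Matrix (Fin N) (Fin N) ℝ,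
      (∀ i j, i < j → M i j = 0) ∧ A = M * M.transpose := by
    refine ⟨LDL.lower hA * Matrix.diagonal fun i => √(LDL.diagEntries hA i), ?_, ?_⟩
    · intro i j hij
      simp [Matrix.mul_diagonal, htri i j hij]
    · conv_lhs => rw [← LDL.lower_conj_diag hA]
      rw [Matrix.transpose_mul, Matrix.diagonal_transpose, Matrix.mul_assoc, Matrix.mul_assoc,
        ← Matrix.mul_assoc (Matrix.diagonal _) (Matrix.diagonal _), Matrix.diagonal_mul_diagonal,
        Matrix.conjTranspose_eq_transpose_of_trivial]
      simp [LDL.diag, Real.mul_self_sqrt (hD _)]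
  obtain ⟨M, hM1, hM2⟩ := hM
  have hne : ∀ i, M i i ≠ 0 := by
    intro i hi
    have hdet : A.det = 0 := by
      have h0 : ∏ j, M j j = 0 := Finset.prod_eq_zero (Finset.mem_univ i) hi
      rw [hM2, Matrix.det_mul, Matrix.det_of_isLowerTriangular M fun i j hij => hM1 i j hij, h0,
        zero_mul]
    exact hA.det_pos.ne' hdet
  -- The diagonal of `M` is known only to be nonzero, from `det A ≠ 0`. Flipping the signs of
  -- columns makes it positive and does not change `M * Mᵀ`.
  refine ⟨M * Matrix.diagonal fun i => (SignType.sign (M i i) : ℝ), ?_, ?_, ?_⟩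
  · intro i j hij
    simp [Matrix.mul_diagonal, hM1 i j hij]
  · intro i
    rw [Matrix.mul_diagonal, self_mul_sign]
    exact abs_pos.2 (hne i)
  · have h1 : ∀ i, ((SignType.sign (M i i) : SignType) : ℝ) * (SignType.sign (M i i) : SignType)
        = 1 := by
      intro i
      rcases lt_or_gt_of_ne (hne i) with h | h
      · simp [sign_neg h]
      · simp [sign_pos h]
    rw [Matrix.transpose_mul, Matrix.diagonal_transpose, Matrix.mul_assoc,
      ← Matrix.mul_assoc (Matrix.diagonal _) (Matrix.diagonal _), Matrix.diagonal_mul_diagonal]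
    simp [h1, ← hM2]

/-! ### Progress of the factorization

The elementary operations with target `(i, j)` are always executed in the order of their column
index `k = 0, …, j`. The progress of a cell is the number of operations executed so far. -/

/-- The value of the cell `c` of the factorization of `L * Lᵀ` after its first `p` operations. -/
noncomputable def partialValue (L : ℕ → ℕ → ℝ) (p : ℕ) (c : Cell) : ℝ :=
  if c.2 < p then L c.1 c.2 else ∑ l ∈ Finset.Ico p (c.2 + 1), L c.1 l * L c.2 l

/-- The index of the column used by an operation. -/
def Op.column : Op → ℕ
  | .root k => k
  | .quot _ k => k
  | .update _ _ k => k

/-- The operation is the next one for its target, and its other operands are final. -/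
def Op.Ready (N : ℕ) (P : Cell → ℕ) : Op → Prop
  | .root k => k < N ∧ P (k, k) = k
  | .quot i k => k < i ∧ i < N ∧ P (i, k) = k ∧ k < P (k, k)
  | .update i j k => k < j ∧ j ≤ i ∧ i < N ∧ P (i, j) = k ∧ k < P (i, k) ∧ k < P (j, k)

/-- The entries in `R` are in fast memory, with the values prescribed by the progress `P`; so are
the entries in slow memory, outside of `D`. -/
structure Tracks (N : ℕ) (L : ℕ → ℕ → ℝ) (R D : Finset Cell) (P : Cell → ℕ) (m : Memory) :
    Prop where
  resident : m.resident = R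
  slow : ∀ c : Cell, c ∉ D → c.2 ≤ c.1 → c.1 < N → m.slow c = partialValue L (P c) c
  cache : ∀ c : Cell, c ∈ R → c.2 ≤ c.1 → c.1 < N → m.cache c = partialValue L (P c) c

/-- The program runs from every state described by `R`, `D`, `P` to one described by `R'`, `D'`,
`P'`. -/
def Exec (S N : ℕ) (L : ℕ → ℕ → ℝ) (p : Program) (R D : Finset Cell) (P : Cell → ℕ)
    (R' D' : Finset Cell) (P' : Cell → ℕ) : Prop :=
  ∀ m, Tracks N L R D P m → ∃ m', run S p m = some m' ∧ Tracks N L R' D' P' m'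

/-! ### Hoare rules for instructions and instruction lists. -/

section Rules

variable {S N : ℕ} {L : ℕ → ℕ → ℝ} {R R' R'' D D' D'' : Finset Cell} {P P' P'' : Cell → ℕ}
  {p q : Program}

theorem run_append (S : ℕ) (p q : Program) (m : Memory) :
    run S (p ++ q) m = (run S p m).bind (run S q) := by
  induction p generalizing m with
  | nil => rfl
  | cons s p ih =>
    simp only [List.cons_append, run, Option.bind_assoc]
    congr 1
    funext m'
    exact ih m'

theorem Exec.nil : Exec S N L [] R D P R D P := fun m h => ⟨m, rfl, h⟩

theorem Exec.append (h : Exec S N L p R D P R' D' P') (h' : Exec S N L q R' D' P' R'' D'' P'') :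
    Exec S N L (p ++ q) R D P R'' D'' P'' := by
  intro m hm
  obtain ⟨m', e, hm'⟩ := h m hm
  obtain ⟨m'', e', hm''⟩ := h' m' hm'
  exact ⟨m'', by rw [run_append, e]; exact e', hm''⟩

theorem Exec.cons {s : Instr} (h : Exec S N L [s] R D P R' D' P')
    (h' : Exec S N L q R' D' P' R'' D'' P'') : Exec S N L (s :: q) R D P R'' D'' P'' :=
  h.append h'

theorem Tracks.congr {m : Memory} (h : Tracks N L R D P m)
    (hP : ∀ c : Cell, c.2 ≤ c.1 → c.1 < N → P c = P' c) : Tracks N L R D P' m :=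
  ⟨h.resident, fun c hc h1 h2 => hP c h1 h2 ▸ h.slow c hc h1 h2,
    fun c hc h1 h2 => hP c h1 h2 ▸ h.cache c hc h1 h2⟩

theorem Exec.congr_right (h : Exec S N L p R D P R' D' P')
    (hP : ∀ c : Cell, c.2 ≤ c.1 → c.1 < N → P' c = P'' c) : Exec S N L p R D P R' D' P'' := by
  intro m hm
  obtain ⟨m', e, hm'⟩ := h m hm
  exact ⟨m', e, hm'.congr hP⟩

theorem Exec.congr_left (h : Exec S N L p R D P R' D' P')
    (hP : ∀ c : Cell, c.2 ≤ c.1 → c.1 < N → P'' c = P c) : Exec S N L p R D P'' R' D' P' :=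
  fun m hm => h m (hm.congr hP)

/-- Declaring more slow copies out of date only weakens what is known of the state. This allows a
whole block to be marked as stale right after loading, before any of its entries changes. -/
theorem Exec.mono_stale (h : Exec S N L p R D P R' D' P') (hD : D'' ⊆ D) :
    Exec S N L p R D'' P R' D' P' :=
  fun m hm => h m ⟨hm.resident, fun c hc => hm.slow c fun h => hc (hD h), hm.cache⟩

theorem Exec.load {c : Cell} (hc : c ∉ D) (hS : (insert c R).card ≤ S) :
    Exec S N L [.load c] R D P (insert c R) D P := by
  intro m hm
  refine ⟨{ m with
          resident := insert c m.resident
          cache := Function.update m.cache c (m.slow c) }, ?_, ?_⟩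
  · simp [run, step, hm.resident, hS]
  · refine ⟨by simp [hm.resident], hm.slow, ?_⟩
    intro d hd h1 h2
    rcases eq_or_ne d c with rfl | hne
    · simpa using hm.slow d hc h1 h2
    · simpa [Function.update_of_ne hne] using hm.cache d (by simpa [hne] using hd) h1 h2

theorem Exec.store {c : Cell} (hc : c ∈ R) : Exec S N L [.store c] R D P R (D.erase c) P := by
  intro m hm
  refine ⟨{ m with slow := Function.update m.slow c (m.cache c) }, ?_, ?_⟩
  · simp [run, step, hm.resident, hc]
  · refine ⟨hm.resident, ?_, hm.cache⟩
    intro d hd h1 h2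
    rcases eq_or_ne d c with rfl | hne
    · simpa using hm.cache d hc h1 h2
    · simpa [Function.update_of_ne hne] using hm.slow d (by simpa [hne] using hd) h1 h2

theorem Exec.evict {c : Cell} (hc : c ∈ R) : Exec S N L [.evict c] R D P (R.erase c) D P := by
  intro m hm
  refine ⟨{ m with resident := m.resident.erase c }, ?_, ?_⟩
  · simp [run, step, hm.resident, hc]
  · exact ⟨by simp [hm.resident], hm.slow, fun d hd => hm.cache d (Finset.mem_of_mem_erase hd)⟩

theorem partialValue_of_lt {n : ℕ} {c : Cell} (h : c.2 < n) : partialValue L n c = L c.1 c.2 :=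
  if_pos h

theorem partialValue_self (i k : ℕ) : partialValue L k (i, k) = L i k * L k k := by
  simp [partialValue]

/-- All the arithmetic of the factorization is here. At progress `k` the cell `(i, k)` has only the
term `L i k * L k k` left, so that a root or a quotient yields the final entry, by positivity of the
diagonal; an update removes the term `l = k` from a longer tail. -/
theorem Op.Ready.result_eq {o : Op} {x : Cell → ℝ} (hL : ∀ k < N, 0 < L k k)
    (ho : o.Ready N P)
    (hx : ∀ c ∈ o.operands, c.2 ≤ c.1 → c.1 < N → x c = partialValue L (P c) c) :
    o.result x = partialValue L (o.column + 1) o.target := by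
  cases o with
  | root k =>
    obtain ⟨h1, h2⟩ := ho
    have e := hx (k, k) (by simp [Op.operands]) le_rfl h1
    rw [h2, partialValue_self] at e
    simp only [Op.result, Op.column, Op.target, e]
    rw [Real.sqrt_mul_self (hL k h1).le, partialValue_of_lt (by simp)]
  | quot i k =>
    obtain ⟨h1, h2, h3, h4⟩ := ho
    have e := hx (i, k) (by simp [Op.operands]) h1.le h2
    have e' := hx (k, k) (by simp [Op.operands]) le_rfl (h1.trans h2)
    rw [h3, partialValue_self] at e
    rw [partialValue_of_lt h4] at e'
    simp only [Op.result, Op.column, Op.target, e, e']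
    rw [partialValue_of_lt (by simp), mul_div_cancel_right₀ _ (hL k (h1.trans h2)).ne']
  | update i j k =>
    obtain ⟨h1, h2, h3, h4, h5, h6⟩ := ho
    have e := hx (i, j) (by simp [Op.operands]) h2 h3
    have e' := hx (i, k) (by simp [Op.operands]) (by simp; omega) h3
    have e'' := hx (j, k) (by simp [Op.operands]) (by simp; omega) (by simp; omega)
    rw [h4] at e
    rw [partialValue_of_lt h5] at e'
    rw [partialValue_of_lt h6] at e''
    simp only [Op.result, Op.column, Op.target, e, e', e'']
    rw [partialValue, partialValue, if_neg (by dsimp only; omega), if_neg (by dsimp only; omega),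
      ← Finset.sum_Ioo_add_eq_sum_Ico (a := k) (b := j + 1) (by omega)]
    have : Finset.Ioo k (j + 1) = Finset.Ico (k + 1) (j + 1) := by
      ext; simp
    rw [this]
    ring

/-- The target has to be in `D`: the computation changes only the cached copy, so the slow copy
falls behind the new progress. -/
theorem Exec.compute {o : Op} (hL : ∀ k < N, 0 < L k k) (hR : o.operands ⊆ R)
    (hD : o.target ∈ D) (ho : o.Ready N P) :
    Exec S N L [.compute o] R D P R D (Function.update P o.target (o.column + 1)) := by
  intro m hm
  refine ⟨{ m with cache := Function.update m.cache o.target (o.result m.cache) }, ?_, ?_⟩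
  · simp [run, step, hm.resident, hR]
  · refine ⟨hm.resident, ?_, ?_⟩
    · intro d hd h1 h2
      have hne : d ≠ o.target := fun h => hd (h ▸ hD)
      simpa [Function.update_of_ne hne] using hm.slow d hd h1 h2
    · intro d hd h1 h2
      rcases eq_or_ne d o.target with rfl | hne
      · simpa using ho.result_eq hL fun c hc => hm.cache c (hR hc)
      · simpa [Function.update_of_ne hne] using hm.cache d hd h1 h2

theorem Exec.loads {cs : List Cell} (hc : ∀ c ∈ cs, c ∉ D) (hS : (R ∪ cs.toFinset).card ≤ S) :
    Exec S N L (loads cs) R D P (R ∪ cs.toFinset) D P := by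
  induction cs generalizing R with
  | nil => simpa [OutOfCore.loads] using Exec.nil
  | cons c cs ih =>
    have e : R ∪ (c :: cs).toFinset = insert c R ∪ cs.toFinset := by
      ext; simp only [List.toFinset_cons, Finset.mem_union, Finset.mem_insert]; tauto
    rw [e] at hS ⊢
    refine Exec.cons (Exec.load (hc c (by simp))
      ((Finset.card_le_card Finset.subset_union_left).trans hS)) ?_
    exact ih (fun c h => hc c (by simp [h])) hS

theorem Exec.stores {cs : List Cell} (hc : ∀ c ∈ cs, c ∈ R) :
    Exec S N L (cs.map Instr.store) R D P R (D \ cs.toFinset) P := by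
  induction cs generalizing D with
  | nil => simpa using Exec.nil
  | cons c cs ih =>
    have e : D \ (c :: cs).toFinset = D.erase c \ cs.toFinset := by
      ext
      simp only [List.toFinset_cons, Finset.mem_sdiff, Finset.mem_insert, Finset.mem_erase]
      tauto
    rw [e]
    exact Exec.cons (Exec.store (hc c (by simp))) (ih fun c h => hc c (by simp [h]))

theorem Exec.evicts {cs : List Cell} (hc : ∀ c ∈ cs, c ∈ R) (hn : cs.Nodup) :
    Exec S N L (evicts cs) R D P (R \ cs.toFinset) D P := by
  induction cs generalizing R with
  | nil => simpa [OutOfCore.evicts] using Exec.nil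
  | cons c cs ih =>
    have e : R \ (c :: cs).toFinset = R.erase c \ cs.toFinset := by
      ext
      simp only [List.toFinset_cons, Finset.mem_sdiff, Finset.mem_insert, Finset.mem_erase]
      tauto
    rw [e]
    rw [List.nodup_cons] at hn
    refine Exec.cons (Exec.evict (hc c (by simp))) (ih (fun d h => ?_) hn.2)
    exact Finset.mem_erase.2 ⟨fun e => hn.1 (e ▸ h), hc d (by simp [h])⟩

/-- Programs between two copies of a block of entries: load it, work on it, write it back. -/
theorem Exec.block {cells : List Cell} (hn : cells.Nodup) (hS : cells.length ≤ S)
    (h : Exec S N L p cells.toFinset cells.toFinset P cells.toFinset cells.toFinset P') :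
    Exec S N L (OutOfCore.loads cells ++ p ++ flush cells) ∅ ∅ P ∅ ∅ P' := by
  have e : (∅ : Finset Cell) ∪ cells.toFinset = cells.toFinset := by simp
  have e' : cells.toFinset \ cells.toFinset = ∅ := by simp
  have h1 := Exec.loads (S := S) (N := N) (L := L) (P := P) (R := ∅) (D := ∅) (cs := cells)
    (by simp) (by rw [e]; exact (List.toFinset_card_le _).trans hS)
  rw [e] at h1
  have h2 := Exec.stores (S := S) (N := N) (L := L) (P := P') (D := cells.toFinset) (cs := cells)
    (R := cells.toFinset) (by simp)
  have h3 := Exec.evicts (S := S) (N := N) (L := L) (P := P') (D := ∅) (cs := cells)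
    (R := cells.toFinset) (by simp) hn
  rw [e'] at h2 h3
  exact (h1.append (h.mono_stale (by simp))).append (h2.append h3)

/-- Load some further entries, use them, and evict them. -/
theorem Exec.stream {cs : List Cell} (hn : cs.Nodup) (hD : ∀ c ∈ cs, c ∉ D) (hR : ∀ c ∈ cs, c ∉ R)
    (hS : (R ∪ cs.toFinset).card ≤ S)
    (h : Exec S N L p (R ∪ cs.toFinset) D P (R ∪ cs.toFinset) D P') :
    Exec S N L (OutOfCore.loads cs ++ p ++ OutOfCore.evicts cs) R D P R D P' := by
  have e : (R ∪ cs.toFinset) \ cs.toFinset = R := by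
    ext c
    have := hR c
    simp only [Finset.mem_sdiff, Finset.mem_union, List.mem_toFinset]
    tauto
  have h3 := Exec.evicts (S := S) (N := N) (L := L) (P := P') (D := D) (cs := cs)
    (R := R ∪ cs.toFinset) (by simp +contextual) hn
  rw [e] at h3
  exact ((Exec.loads hD hS).append h).append h3

/-! ### Loops -/

theorem Exec.flatMap_range {n : ℕ} {f : ℕ → Program} (Φ : ℕ → Cell → ℕ)
    (h : ∀ s < n, Exec S N L (f s) R D (Φ s) R D (Φ (s + 1))) :
    Exec S N L ((List.range n).flatMap f) R D (Φ 0) R D (Φ n) := by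
  induction n with
  | zero => simpa using Exec.nil
  | succ n ih =>
    rw [List.range_succ, List.flatMap_append]
    refine (ih fun s hs => h s (by omega)).append ?_
    simpa using h n (by omega)

theorem Exec.flatMap_interval {a b : ℕ} (hab : a ≤ b) {f : ℕ → Program} (Φ : ℕ → Cell → ℕ)
    (h : ∀ k, a ≤ k → k < b → Exec S N L (f k) R D (Φ k) R D (Φ (k + 1))) :
    Exec S N L ((interval a b).flatMap f) R D (Φ a) R D (Φ b) := by
  have := Exec.flatMap_range (S := S) (N := N) (L := L) (R := R) (D := D) (n := b - a)
    (f := fun s => f (a + s)) (fun s => Φ (a + s)) fun s hs => h (a + s) (by omega) (by omega)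
  simp only [interval, List.range'_eq_map_range, List.flatMap_map]
  simpa [Nat.add_sub_cancel' hab] using this

/-- The invariant is indexed by the boundary coordinate reached so far, not by the number of the
tile, so that bodies never see the division that defines the tiles. In the proof the coordinate is
capped at `b`, which handles the shorter last tile. -/
theorem Exec.flatMap_tiles {t a b : ℕ} (ht : 0 < t) (hab : a ≤ b) {f : ℕ × ℕ → Program}
    (Φ : ℕ → Cell → ℕ)
    (h : ∀ x y, a ≤ x → x < y → y ≤ b → y ≤ x + t →
      Exec S N L (f (x, y)) R D (Φ x) R D (Φ y)) :
    Exec S N L ((tiles t a b).flatMap f) R D (Φ a) R D (Φ b) := by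
  have hlt : ∀ s, s < (b - a + t - 1) / t → a + s * t < b := by
    intro s hs
    have h1 := (Nat.lt_div_iff_mul_lt ht).1 hs
    omega
  have hlast : b ≤ a + (b - a + t - 1) / t * t := by
    have := Nat.lt_div_mul_add (a := b - a + t - 1) ht
    omega
  have := Exec.flatMap_range (S := S) (N := N) (L := L) (R := R) (D := D) (n := (b - a + t - 1) / t)
    (f := fun s => f (a + s * t, min (a + (s + 1) * t) b)) (fun s => Φ (min (a + s * t) b)) ?_
  · simp only [tiles, List.flatMap_map]
    simpa [min_eq_left hab, min_eq_right hlast] using this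
  · intro s hs
    have h1 := hlt s hs
    have h2 : a + (s + 1) * t = a + s * t + t := by ring
    have h3 := h (a + s * t) (min (a + (s + 1) * t) b) (by omega) (by omega) (by omega) (by omega)
    rwa [min_eq_left h1.le]

open Classical in
/-- The progress `P` outside of the region `T`, and `g` on `T`. -/
noncomputable def advance (T : Set Cell) (g P : Cell → ℕ) : Cell → ℕ :=
  fun c => if c ∈ T then g c else P c

theorem advance_of_mem {T : Set Cell} {g : Cell → ℕ} {c : Cell} (h : c ∈ T) :
    advance T g P c = g c := if_pos h

theorem advance_of_notMem {T : Set Cell} {g : Cell → ℕ} {c : Cell} (h : c ∉ T) :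
    advance T g P c = P c := if_neg h

/-- Loop over pairwise disjoint regions. -/
theorem Exec.sweep {ι : Type*} {l : List ι} {T : ι → Set Cell} {g : Cell → ℕ} {f : ι → Program}
    (hl : l.Pairwise fun x y => Disjoint (T x) (T y))
    (hg : ∀ x ∈ l, ∀ c ∈ T x, P c ≤ g c)
    (h : ∀ x ∈ l, ∀ Q : Cell → ℕ, (∀ c, P c ≤ Q c) → (∀ c ∈ T x, Q c = P c) →
      Exec S N L (f x) R D Q R D (advance (T x) g Q)) :
    Exec S N L (l.flatMap f) R D P R D (advance {c | ∃ x ∈ l, c ∈ T x} g P) := by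
  induction l generalizing P with
  | nil =>
    refine Exec.nil.congr_right fun c _ _ => ?_
    rw [advance_of_notMem (by simp)]
  | cons x l ih =>
    rw [List.pairwise_cons] at hl
    have hdis : ∀ y ∈ l, ∀ c ∈ T y, c ∉ T x := fun y hy c hc hx =>
      Set.disjoint_left.1 (hl.1 y hy) hx hc
    have hle : ∀ c, P c ≤ advance (T x) g P c := by
      intro c
      by_cases hc : c ∈ T x
      · rw [advance_of_mem hc]; exact hg x (by simp) c hc
      · rw [advance_of_notMem hc]
    rw [List.flatMap_cons]
    -- The body is assumed to run from every `Q ≥ P` that agrees with `P` on its own region. What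
    -- the other regions have reached then does not matter: conditions of the form "operand final"
    -- are monotone in the progress.
    refine (h x (by simp) P (fun _ => le_rfl) fun _ _ => rfl).append
      ((ih (P := advance (T x) g P) hl.2 ?_ ?_).congr_right ?_)
    · intro y hy c hc
      rw [advance_of_notMem (hdis y hy c hc)]
      exact hg y (by simp [hy]) c hc
    · intro y hy Q hQ hQ'
      refine h y (by simp [hy]) Q (fun c => (hle c).trans (hQ c)) fun c hc => ?_
      rw [hQ' c hc, advance_of_notMem (hdis y hy c hc)]
    · intro c _ _
      have e : (c ∈ {c | ∃ y ∈ x :: l, c ∈ T y}) ↔ c ∈ T x ∨ c ∈ {c | ∃ y ∈ l, c ∈ T y} := by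
        simp
      simp only [advance, e]
      split_ifs <;> tauto

/-- Loop over operations with different targets and the same column. -/
theorem Exec.computes {ι : Type*} {l : List ι} {o : ι → Op} {k : ℕ} (hL : ∀ k < N, 0 < L k k)
    (hl : l.Pairwise fun x y => (o x).target ≠ (o y).target)
    (hk : ∀ x ∈ l, (o x).column = k ∧ P (o x).target = k)
    (hR : ∀ x ∈ l, (o x).operands ⊆ R) (hD : ∀ x ∈ l, (o x).target ∈ D)
    (ho : ∀ x ∈ l, ∀ Q : Cell → ℕ, (∀ c, P c ≤ Q c) → Q (o x).target = P (o x).target →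
      (o x).Ready N Q) :
    Exec S N L (l.map fun x => Instr.compute (o x)) R D P R D
      (advance {c | ∃ x ∈ l, c = (o x).target} (fun _ => k + 1) P) := by
  have := Exec.sweep (S := S) (N := N) (L := L) (R := R) (D := D) (P := P) (l := l)
    (T := fun x => {(o x).target}) (g := fun _ => k + 1) (f := fun x => [Instr.compute (o x)])
    (hl.imp fun h => by simpa using h) (fun x hx c hc => by
      rw [Set.mem_singleton_iff.1 hc, (hk x hx).2]; omega) ?_
  · rwa [List.map_eq_flatMap]
  · intro x hx Q hQ hQ'
    refine (Exec.compute hL (hR x hx) (hD x hx)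
      (ho x hx Q hQ (hQ' _ rfl))).congr_right fun c _ _ => ?_
    rw [(hk x hx).1]
    by_cases hc : c = (o x).target
    · simp [advance, hc]
    · simp [advance, hc]

end Rules

/-! ### Intervals and tiles -/

theorem mem_interval {a b x : ℕ} : x ∈ interval a b ↔ a ≤ x ∧ x < b := by
  simp only [interval, List.mem_range'_1]
  omega

theorem mem_product_iff {α β : Type*} {xs : List α} {ys : List β} {c : α × β} :
    c ∈ xs ×ˢ ys ↔ c.1 ∈ xs ∧ c.2 ∈ ys := List.mem_product

theorem nodup_interval (a b : ℕ) : (interval a b).Nodup := List.nodup_range'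

theorem length_interval (a b : ℕ) : (interval a b).length = b - a := by simp [interval]

theorem tileSide_pos {S : ℕ} (hS : 3 ≤ S) : 0 < tileSide S := by
  have : 2 ≤ Nat.sqrt (S + 1) := Nat.le_sqrt.2 (by omega)
  unfold tileSide
  omega

theorem tileSide_le (S : ℕ) : tileSide S * tileSide S + 2 * tileSide S ≤ S := by
  have h1 : 1 ≤ Nat.sqrt (S + 1) := Nat.le_sqrt.2 (by omega)
  have h2 := Nat.sqrt_le (S + 1)
  obtain ⟨t, ht⟩ := Nat.exists_eq_add_of_le h1
  rw [tileSide, ht, Nat.add_sub_cancel_left]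
  rw [ht] at h2
  nlinarith

/-- The part of the lower triangle in the rows `x₀ ≤ · < x₁` and the columns `y₀ ≤ · < y₁`. -/
def lowerBox (x₀ x₁ y₀ y₁ : ℕ) : Set Cell :=
  {c | (x₀ ≤ c.1 ∧ c.1 < x₁) ∧ (y₀ ≤ c.2 ∧ c.2 < y₁) ∧ c.2 ≤ c.1}

theorem mem_lowerBox {x₀ x₁ y₀ y₁ : ℕ} {c : Cell} : c ∈ lowerBox x₀ x₁ y₀ y₁ ↔
    (x₀ ≤ c.1 ∧ c.1 < x₁) ∧ (y₀ ≤ c.2 ∧ c.2 < y₁) ∧ c.2 ≤ c.1 := Iff.rfl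

section Blocks

variable {S N : ℕ} {L : ℕ → ℕ → ℝ} {P : Cell → ℕ}

/-! ### Symmetric updates -/

/-- The block lies in columns `≥ hi` and its operands in columns `< hi`, so streamed entries never
collide with the block. One pass of the loop lifts all cells of the block from `k` to `k + 1`
together. -/
theorem Exec.accumulate {cells : List Cell} {rows : List ℕ} {lo hi : ℕ}
    (hL : ∀ k < N, 0 < L k k) (hlh : lo ≤ hi) (hn : cells.Nodup) (hrn : rows.Nodup)
    (hS : cells.length + rows.length ≤ S)
    (hc : ∀ c ∈ cells, hi ≤ c.2 ∧ c.2 ≤ c.1 ∧ c.1 < N ∧ c.1 ∈ rows ∧ c.2 ∈ rows ∧ P c = lo)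
    (hr : ∀ r ∈ rows, ∀ k, lo ≤ k → k < hi → k < P (r, k)) :
    Exec S N L (accumulate cells rows (interval lo hi)) cells.toFinset cells.toFinset P
      cells.toFinset cells.toFinset (advance {c | c ∈ cells} (fun _ => hi) P) := by
  have h := Exec.flatMap_interval (S := S) (N := N) (L := L) (R := cells.toFinset)
    (D := cells.toFinset)
    hlh (f := fun k => OutOfCore.loads (rows.map fun r => (r, k)) ++
      (cells.map fun c => Instr.compute (.update c.1 c.2 k)) ++
      OutOfCore.evicts (rows.map fun r => (r, k)))
    (fun k => advance {c | c ∈ cells} (fun _ => k) P) ?_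
  · refine h.congr_left fun c _ _ => ?_
    by_cases h : c ∈ cells
    · rw [advance_of_mem h, (hc c h).2.2.2.2.2]
    · rw [advance_of_notMem h]
  · intro k hk1 hk2
    have hout : ∀ r, (r, k) ∉ cells := fun r h => by
      have := (hc _ h).1
      dsimp only at this
      omega
    refine Exec.stream (hrn.map fun a b h => by simpa using h) ?_ ?_ ?_ ?_
    · simp only [List.mem_map, List.mem_toFinset]
      rintro _ ⟨r, _, rfl⟩
      exact hout r
    · simp only [List.mem_map, List.mem_toFinset]
      rintro _ ⟨r, _, rfl⟩
      exact hout r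
    · refine (Finset.card_union_le _ _).trans (le_trans (add_le_add (List.toFinset_card_le _)
        (List.toFinset_card_le _)) ?_)
      simpa using hS
    · refine (Exec.computes (k := k) (o := fun c : Cell => .update c.1 c.2 k) hL
        (hn.imp fun h => h) ?_ ?_ ?_ ?_).congr_right ?_
      · intro c h
        exact ⟨rfl, advance_of_mem h⟩
      · intro c h d hd
        obtain ⟨_, _, _, h1, h2, _⟩ := hc c h
        simp only [Op.operands, Finset.mem_insert, Finset.mem_singleton] at hd
        simp only [Finset.mem_union, List.mem_toFinset, List.mem_map]
        rcases hd with rfl | rfl | rfl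
        · exact Or.inl h
        · exact Or.inr ⟨_, h1, rfl⟩
        · exact Or.inr ⟨_, h2, rfl⟩
      · intro c h
        simpa [Op.target] using h
      · intro c h Q hQ hQ'
        obtain ⟨h0, h1, h2, h3, h4, h5⟩ := hc c h
        have hQ'' : Q c = k := hQ'.trans (advance_of_mem h)
        have hlt : ∀ r ∈ rows, k < Q (r, k) := fun r hr' => by
          refine lt_of_lt_of_le ?_ (hQ (r, k))
          rw [advance_of_notMem (hout r)]
          exact hr r hr' k hk1 hk2
        exact ⟨by omega, h1, h2, hQ'', hlt _ h3, hlt _ h4⟩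
      · intro c _ _
        by_cases h : c ∈ cells
        · rw [advance_of_mem (by exact ⟨c, h, rfl⟩), advance_of_mem h]
        · rw [advance_of_notMem (by rintro ⟨x, hx, rfl⟩; exact h hx), advance_of_notMem h,
            advance_of_notMem h]

theorem Exec.syrkBlock {cells : List Cell} {rows : List ℕ} {lo hi : ℕ}
    (hL : ∀ k < N, 0 < L k k) (hlh : lo ≤ hi) (hn : cells.Nodup) (hrn : rows.Nodup)
    (hS : cells.length + rows.length ≤ S)
    (hc : ∀ c ∈ cells, hi ≤ c.2 ∧ c.2 ≤ c.1 ∧ c.1 < N ∧ c.1 ∈ rows ∧ c.2 ∈ rows ∧ P c = lo)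
    (hr : ∀ r ∈ rows, ∀ k, lo ≤ k → k < hi → k < P (r, k)) :
    Exec S N L (syrkBlock cells rows (interval lo hi)) ∅ ∅ P ∅ ∅
      (advance {c | c ∈ cells} (fun _ => hi) P) :=
  Exec.block hn (by omega) (Exec.accumulate hL hlh hn hrn hS hc hr)

/-- Row and column tiles need not be aligned when `p ≠ r`, so a tile may meet the diagonal in any
way. The streamed rows are those of `J` and the rows of `I` beyond `J`: no duplicates, and enough,
since a row of a lower-triangular cell lies in `J` or past its end. -/
theorem Exec.oocSyrk {r p n lo hi : ℕ} (hS : 3 ≤ S) (hL : ∀ k < N, 0 < L k k) (hlh : lo ≤ hi)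
    (hir : hi ≤ r) (hp : r ≤ p) (hpn : p ≤ r + n) (hN : r + n ≤ N)
    (hP : ∀ c ∈ lowerBox p (r + n) r (r + n), P c = lo)
    (hr : ∀ x k, r ≤ x → x < r + n → lo ≤ k → k < hi → k < P (x, k)) :
    Exec S N L (oocSyrk S r p n (interval lo hi)) ∅ ∅ P ∅ ∅
      (advance (lowerBox p (r + n) r (r + n)) (fun _ => hi) P) := by
  have ht := tileSide_le S
  have h := Exec.flatMap_tiles (S := S) (N := N) (L := L) (R := ∅) (D := ∅) (tileSide_pos hS) hpn
    (f := fun I => (tiles (tileSide S) r I.2).flatMap fun J =>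
      OutOfCore.syrkBlock
        (((interval I.1 I.2) ×ˢ (interval J.1 J.2)).filter fun c => c.2 ≤ c.1)
        ((interval J.1 J.2) ++
          (interval I.1 I.2).filter fun x => J.2 ≤ x)
        (interval lo hi))
    (fun q => advance (lowerBox p q r (r + n)) (fun _ => hi) P) ?_
  · refine h.congr_left fun c _ _ => ?_
    rw [advance_of_notMem]
    rw [mem_lowerBox]
    omega
  intro x₀ x₁ hx0 hx1 hx2 hx3
  have h := Exec.flatMap_tiles (S := S) (N := N) (L := L) (R := ∅) (D := ∅) (tileSide_pos hS)
    (show r ≤ x₁ by omega)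
    (f := fun J => OutOfCore.syrkBlock
        (((interval x₀ x₁) ×ˢ (interval J.1 J.2)).filter fun c => c.2 ≤ c.1)
        ((interval J.1 J.2) ++
          (interval x₀ x₁).filter fun x => J.2 ≤ x)
        (interval lo hi))
    (fun z => advance (lowerBox x₀ x₁ r z) (fun _ => hi)
      (advance (lowerBox p x₀ r (r + n)) (fun _ => hi) P)) ?_
  · refine (h.congr_left fun c _ _ => ?_).congr_right fun c _ _ => ?_
    · rw [advance_of_notMem (T := lowerBox x₀ x₁ r r)]
      rw [mem_lowerBox]
      omega
    · simp only [advance, mem_lowerBox]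
      split_ifs <;> omega
  intro y₀ y₁ hy0 hy1 hy2 hy3
  refine (Exec.syrkBlock hL hlh ?_ ?_ ?_ ?_ ?_).congr_right ?_
  · exact ((nodup_interval _ _).product (nodup_interval _ _)).filter _
  · rw [List.nodup_append']
    refine ⟨nodup_interval _ _, (nodup_interval _ _).filter _, fun x h1 h2 => ?_⟩
    simp only [List.mem_filter, mem_interval, decide_eq_true_eq] at h1 h2
    omega
  · have h1 := List.length_filter_le (fun c : Cell => decide (c.2 ≤ c.1))
      ((interval x₀ x₁) ×ˢ (interval y₀ y₁))
    have h2 := List.length_filter_le (fun x => decide (y₁ ≤ x)) (interval x₀ x₁)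
    rw [List.length_product, length_interval, length_interval] at h1
    rw [length_interval] at h2
    rw [List.length_append, length_interval]
    dsimp only
    have h3 : (x₁ - x₀) * (y₁ - y₀) ≤ tileSide S * tileSide S :=
      Nat.mul_le_mul (by omega) (by omega)
    omega
  · intro c hc
    simp only [List.mem_filter, mem_product_iff, mem_interval, decide_eq_true_eq] at hc
    simp only [List.mem_append, List.mem_filter, mem_interval, decide_eq_true_eq]
    have := hP c (by rw [mem_lowerBox]; omega)
    simp only [advance, mem_lowerBox]
    split_ifs <;> omega
  · intro x hx k h1 h2
    simp only [List.mem_append, List.mem_filter, mem_interval, decide_eq_true_eq] at hx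
    have := hr x k (by omega) (by omega) h1 h2
    simp only [advance, mem_lowerBox]
    split_ifs <;> omega
  · intro c _ _
    have e : c ∈ {c | c ∈ ((interval x₀ x₁) ×ˢ (interval y₀ y₁)).filter
        fun c => c.2 ≤ c.1} ↔ c ∈ lowerBox x₀ x₁ y₀ y₁ := by
      simp [mem_interval, mem_lowerBox, mem_product_iff, and_assoc]
    simp only [advance, mem_lowerBox] at e ⊢
    simp only [e]
    split_ifs <;> omega

/-! ### Triangular solve -/

/-- Since `y₁ ≤ x₀`, the tile lies strictly below the triangle, so the streamed pieces of the
triangle are disjoint from it. With the tile of at most `t²` entries there is room for `2 t` entries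
in the first phase, while the second needs only `t`. -/
theorem Exec.trsmTile {a x₀ x₁ y₀ y₁ t : ℕ} (hL : ∀ k < N, 0 < L k k)
    (ht : t * t + 2 * t ≤ S) (hx : x₀ ≤ x₁) (hxN : x₁ ≤ N) (hxt : x₁ ≤ x₀ + t)
    (hy : y₀ ≤ y₁) (hyt : y₁ ≤ y₀ + t) (hay : a ≤ y₀) (hyx : y₁ ≤ x₀)
    (hP : ∀ c ∈ lowerBox x₀ x₁ y₀ y₁, P c = a)
    (hr : ∀ x k, (x₀ ≤ x ∧ x < x₁ ∨ y₀ ≤ x ∧ x < y₁) → a ≤ k → k < y₀ → k < P (x, k))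
    (hd : ∀ j k, y₀ ≤ k → k ≤ j → j < y₁ → k < P (j, k)) :
    Exec S N L (trsmTile a (x₀, x₁) (y₀, y₁)) ∅ ∅ P ∅ ∅
      (advance (lowerBox x₀ x₁ y₀ y₁) (fun c => c.2 + 1) P) := by
  set cells := (interval x₀ x₁) ×ˢ (interval y₀ y₁) with hcells
  have hmem : ∀ c, c ∈ cells ↔ (x₀ ≤ c.1 ∧ c.1 < x₁) ∧ y₀ ≤ c.2 ∧ c.2 < y₁ := by
    intro c
    rw [hcells, mem_product_iff, mem_interval, mem_interval]
  have hmem' : ∀ c, c ∈ {c | c ∈ cells} ↔ c ∈ lowerBox x₀ x₁ y₀ y₁ := by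
    intro c
    refine (hmem c).trans ?_
    rw [mem_lowerBox]
    omega
  have hn : cells.Nodup := (nodup_interval _ _).product (nodup_interval _ _)
  have hlen : cells.length ≤ t * t := by
    rw [hcells, List.length_product, length_interval, length_interval]
    exact Nat.mul_le_mul (by omega) (by omega)
  have h1 : Exec S N L (OutOfCore.accumulate cells
      (interval x₀ x₁ ++ interval y₀ y₁) (interval a y₀))
      cells.toFinset cells.toFinset P cells.toFinset cells.toFinset
      (advance {c | c ∈ cells} (fun _ => y₀) P) := by
    refine Exec.accumulate hL hay hn ?_ ?_ ?_ ?_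
    · rw [List.nodup_append']
      refine ⟨nodup_interval _ _, nodup_interval _ _, fun x h1 h2 => ?_⟩
      simp only [mem_interval] at h1 h2
      omega
    · rw [List.length_append, length_interval, length_interval]
      omega
    · intro c hc
      have h0 := hP c ((hmem' c).1 hc)
      rw [hmem] at hc
      simp only [List.mem_append, mem_interval]
      omega
    · intro x hx k h1 h2
      simp only [List.mem_append, mem_interval] at hx
      exact hr x k hx h1 h2
  have h2 : Exec S N L ((interval y₀ y₁).flatMap fun k =>
      OutOfCore.loads ((interval k y₁).map fun j => (j, k)) ++
      ((interval x₀ x₁).map fun i => Instr.compute (.quot i k)) ++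
      (((interval x₀ x₁) ×ˢ interval (k + 1) y₁).map
        fun c => Instr.compute (.update c.1 c.2 k)) ++
      OutOfCore.evicts ((interval k y₁).map fun j => (j, k)))
      cells.toFinset cells.toFinset (advance {c | c ∈ cells} (fun _ => y₀) P)
      cells.toFinset cells.toFinset
      (advance (lowerBox x₀ x₁ y₀ y₁) (fun c => c.2 + 1) P) := by
    have h := Exec.flatMap_interval (S := S) (N := N) (L := L) (R := cells.toFinset)
      (D := cells.toFinset)
      hy (f := fun k =>
      OutOfCore.loads ((interval k y₁).map fun j => (j, k)) ++
      ((interval x₀ x₁).map fun i => Instr.compute (.quot i k)) ++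
      (((interval x₀ x₁) ×ˢ interval (k + 1) y₁).map
        fun c => Instr.compute (.update c.1 c.2 k)) ++
      OutOfCore.evicts ((interval k y₁).map fun j => (j, k)))
      (fun k => advance (lowerBox x₀ x₁ y₀ y₁) (fun c => min (c.2 + 1) k) P) ?_
    · refine (h.congr_left fun c _ _ => ?_).congr_right fun c _ _ => ?_
      · simp only [advance, hmem', mem_lowerBox]
        split_ifs <;> omega
      · simp only [advance, mem_lowerBox]
        split_ifs <;> omega
    intro k hk1 hk2
    have hdis : ∀ c ∈ (interval k y₁).map fun j => (j, k), c ∉ cells.toFinset := by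
      simp only [List.mem_map, List.mem_toFinset, hmem, mem_interval]
      rintro _ ⟨j, hj, rfl⟩
      dsimp only
      omega
    rw [List.append_assoc (OutOfCore.loads _)]
    refine Exec.stream ((nodup_interval _ _).map fun i j h => by simpa using h) hdis hdis ?_ ?_
    · refine (Finset.card_union_le _ _).trans (le_trans (add_le_add (List.toFinset_card_le _)
        (List.toFinset_card_le _)) ?_)
      rw [List.length_map, length_interval]
      omega
    · have hmemR : ∀ c, c ∈ cells.toFinset ∪ ((interval k y₁).map
          fun j => (j, k)).toFinset ↔ ((x₀ ≤ c.1 ∧ c.1 < x₁) ∧ y₀ ≤ c.2 ∧ c.2 < y₁) ∨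
            ((k ≤ c.1 ∧ c.1 < y₁) ∧ k = c.2) := by
        intro c
        simp [hmem, mem_interval, Prod.ext_iff]
      -- State between the divisions and the updates of step `k`: column `k` is final, the later
      -- columns are still at `k`. For earlier columns the minimum with `c.2 + 1` is attained by
      -- `c.2 + 1` in either case.
      refine Exec.append (P' := advance (lowerBox x₀ x₁ y₀ y₁)
          (fun c => min (c.2 + 1) (if c.2 = k then k + 1 else k)) P)
        ((Exec.computes (k := k) hL ?_ ?_ ?_ ?_ ?_).congr_right ?_)
        ((Exec.computes (k := k) (o := fun c : Cell => .update c.1 c.2 k) hL ?_ ?_ ?_ ?_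
          ?_).congr_right ?_)
      · refine (nodup_interval x₀ x₁).imp fun h => ?_
        simpa [Op.target] using h
      · intro i hi
        rw [mem_interval] at hi
        refine ⟨rfl, ?_⟩
        simp only [Op.target]
        rw [advance_of_mem (by rw [mem_lowerBox]; dsimp only; omega)]
        simp
      · intro i hi c hc
        rw [mem_interval] at hi
        rw [hmemR]
        simp only [Op.operands, Finset.mem_insert, Finset.mem_singleton] at hc
        rcases hc with rfl | rfl <;> dsimp only <;> omega
      · intro i hi
        rw [mem_interval] at hi
        simp only [Op.target, List.mem_toFinset, hmem]
        omega
      · intro i hi Q hQ hQ'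
        rw [mem_interval] at hi
        have e := hQ (k, k)
        rw [advance_of_notMem (by rw [mem_lowerBox]; dsimp only; omega)] at e
        have := hd k k hk1 le_rfl hk2
        refine ⟨by omega, by omega, hQ'.trans ?_, by omega⟩
        simp only [Op.target]
        rw [advance_of_mem (by rw [mem_lowerBox]; dsimp only; omega)]
        simp
      · intro c _ _
        have e : c ∈ {c | ∃ x ∈ interval x₀ x₁, c = (Op.quot x k).target} ↔
            (x₀ ≤ c.1 ∧ c.1 < x₁) ∧ c.2 = k := by
          simp only [Op.target, Prod.ext_iff]
          constructor
          · rintro ⟨x, hx, h1, h2⟩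
            rw [mem_interval] at hx
            omega
          · rintro ⟨h1, h2⟩
            exact ⟨c.1, mem_interval.2 h1, rfl, h2⟩
        simp only [advance, e, mem_lowerBox]
        split_ifs <;> omega
      · exact ((nodup_interval _ _).product (nodup_interval _ _)).imp fun h => h
      · intro c hc
        rw [mem_product_iff, mem_interval, mem_interval] at hc
        refine ⟨rfl, ?_⟩
        simp only [Op.target]
        rw [advance_of_mem (by rw [mem_lowerBox]; dsimp only; omega), if_neg (by dsimp only; omega)]
        dsimp only
        omega
      · intro c hc d hd
        rw [mem_product_iff, mem_interval, mem_interval] at hc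
        rw [hmemR]
        simp only [Op.operands, Finset.mem_insert, Finset.mem_singleton] at hd
        rcases hd with rfl | rfl | rfl <;> dsimp only <;> omega
      · intro c hc
        rw [mem_product_iff, mem_interval, mem_interval] at hc
        simp only [Op.target, List.mem_toFinset, hmem]
        omega
      · intro c hc Q hQ hQ'
        rw [mem_product_iff, mem_interval, mem_interval] at hc
        have e := hQ (c.2, k)
        rw [advance_of_notMem (by rw [mem_lowerBox]; dsimp only; omega)] at e
        have e' := hQ (c.1, k)
        rw [advance_of_mem (by rw [mem_lowerBox]; dsimp only; omega), if_pos rfl] at e'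
        have := hd c.2 k hk1 (by omega) (by omega)
        refine ⟨by omega, by omega, by omega, hQ'.trans ?_, by dsimp only at e'; omega, by omega⟩
        simp only [Op.target]
        rw [advance_of_mem (by rw [mem_lowerBox]; dsimp only; omega), if_neg (by dsimp only; omega)]
        dsimp only
        omega
      · intro c _ _
        have e : c ∈ {c | ∃ x ∈ (interval x₀ x₁) ×ˢ interval (k + 1) y₁,
            c = (Op.update x.1 x.2 k).target} ↔
            (x₀ ≤ c.1 ∧ c.1 < x₁) ∧ k + 1 ≤ c.2 ∧ c.2 < y₁ := by
          simp only [Op.target]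
          constructor
          · rintro ⟨x, hx, rfl⟩
            rwa [mem_product_iff, mem_interval, mem_interval] at hx
          · rintro h
            exact ⟨c, by rwa [mem_product_iff, mem_interval, mem_interval], rfl⟩
        simp only [advance, e, mem_lowerBox]
        split_ifs <;> omega
  have := Exec.block hn (by omega) (h1.append h2)
  simpa only [OutOfCore.trsmTile, List.append_assoc] using this

theorem Exec.oocTrsm {a n p q : ℕ} (hS : 3 ≤ S) (hL : ∀ k < N, 0 < L k k) (hap : a + n ≤ p)
    (hpq : p ≤ q) (hq : q ≤ N) (hP : ∀ c ∈ lowerBox p q a (a + n), P c = a)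
    (hd : ∀ j k, a ≤ k → k ≤ j → j < a + n → k < P (j, k)) :
    Exec S N L (oocTrsm S a n p q) ∅ ∅ P ∅ ∅
      (advance (lowerBox p q a (a + n)) (fun c => c.2 + 1) P) := by
  have h := Exec.flatMap_tiles (S := S) (N := N) (L := L) (R := ∅) (D := ∅) (tileSide_pos hS) hpq
    (f := fun I => (tiles (tileSide S) a (a + n)).flatMap fun J =>
      OutOfCore.trsmTile a I J)
    (fun x => advance (lowerBox p x a (a + n)) (fun c => c.2 + 1) P) ?_
  · refine h.congr_left fun c _ _ => ?_
    rw [advance_of_notMem]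
    rw [mem_lowerBox]
    omega
  intro x₀ x₁ hx0 hx1 hx2 hx3
  have h := Exec.flatMap_tiles (S := S) (N := N) (L := L) (R := ∅) (D := ∅) (tileSide_pos hS)
    (show a ≤ a + n by omega) (f := fun J => OutOfCore.trsmTile a (x₀, x₁) J)
    (fun z => advance (lowerBox x₀ x₁ a z) (fun c => c.2 + 1)
      (advance (lowerBox p x₀ a (a + n)) (fun c => c.2 + 1) P)) ?_
  · refine (h.congr_left fun c _ _ => ?_).congr_right fun c _ _ => ?_
    · rw [advance_of_notMem (T := lowerBox x₀ x₁ a a)]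
      rw [mem_lowerBox]
      omega
    · simp only [advance, mem_lowerBox]
      split_ifs <;> omega
  intro y₀ y₁ hy0 hy1 hy2 hy3
  refine (Exec.trsmTile hL (tileSide_le S) hx1.le (by omega) hx3 hy1.le hy3 hy0 (by omega)
    ?_ ?_ ?_).congr_right ?_
  · intro c hc
    rw [mem_lowerBox] at hc
    rw [advance_of_notMem (by rw [mem_lowerBox]; omega),
      advance_of_notMem (by rw [mem_lowerBox]; omega)]
    exact hP c (by rw [mem_lowerBox]; omega)
  · intro x k hx h1 h2
    have := hd x k h1
    simp only [advance, mem_lowerBox]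
    split_ifs <;> omega
  · intro j k h1 h2 h3
    have := hd j k (by omega) h2 (by omega)
    simp only [advance, mem_lowerBox]
    split_ifs <;> omega
  · intro c _ _
    simp only [advance, mem_lowerBox]
    split_ifs <;> omega

/-! ### Cholesky factorization of a small block -/

/-- After the update with earlier columns all remaining operands lie inside the tile, so nothing
more is loaded. The operations are no longer grouped by column alone, and three nested invariants
follow the order `k`, `i`, `j`. -/
theorem Exec.cholTile {a y₀ y₁ t : ℕ} (hL : ∀ k < N, 0 < L k k)
    (ht : t * t + 2 * t ≤ S) (hy : y₀ ≤ y₁) (hyt : y₁ ≤ y₀ + t) (hyN : y₁ ≤ N) (hay : a ≤ y₀)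
    (hP : ∀ c ∈ lowerBox y₀ y₁ y₀ y₁, P c = a)
    (hr : ∀ x k, y₀ ≤ x → x < y₁ → a ≤ k → k < y₀ → k < P (x, k)) :
    Exec S N L (cholTile a (y₀, y₁)) ∅ ∅ P ∅ ∅
      (advance (lowerBox y₀ y₁ y₀ y₁) (fun c => c.2 + 1) P) := by
  set cells := ((interval y₀ y₁) ×ˢ (interval y₀ y₁)).filter
    fun c => c.2 ≤ c.1 with hcells
  have hmem : ∀ c, c ∈ cells ↔ (y₀ ≤ c.1 ∧ c.1 < y₁) ∧ (y₀ ≤ c.2 ∧ c.2 < y₁) ∧ c.2 ≤ c.1 := by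
    intro c
    rw [hcells, List.mem_filter, mem_product_iff, mem_interval, mem_interval, decide_eq_true_eq,
      and_assoc]
  have hn : cells.Nodup := ((nodup_interval _ _).product (nodup_interval _ _)).filter _
  have hlen : cells.length ≤ t * t := by
    refine (List.length_filter_le _ _).trans ?_
    rw [List.length_product, length_interval]
    exact Nat.mul_le_mul (by omega) (by omega)
  have h1 : Exec S N L (OutOfCore.accumulate cells (interval y₀ y₁)
      (interval a y₀)) cells.toFinset cells.toFinset P cells.toFinset cells.toFinset
      (advance {c | c ∈ cells} (fun _ => y₀) P) := by
    refine Exec.accumulate hL hay hn (nodup_interval _ _) ?_ ?_ ?_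
    · rw [length_interval]
      omega
    · intro c hc
      have h0 := hP c ((hmem c).1 hc)
      rw [hmem] at hc
      simp only [mem_interval]
      omega
    · intro x hx k h1 h2
      rw [mem_interval] at hx
      exact hr x k hx.1 hx.2 h1 h2
  have h2 : Exec S N L ((interval y₀ y₁).flatMap fun k =>
      Instr.compute (.root k) ::
      (interval (k + 1) y₁).flatMap fun i =>
        Instr.compute (.quot i k) ::
        (interval (k + 1) (i + 1)).map fun j => Instr.compute (.update i j k))
      cells.toFinset cells.toFinset (advance {c | c ∈ cells} (fun _ => y₀) P)
      cells.toFinset cells.toFinset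
      (advance (lowerBox y₀ y₁ y₀ y₁) (fun c => c.2 + 1) P) := by
    have h := Exec.flatMap_interval (S := S) (N := N) (L := L) (R := cells.toFinset)
      (D := cells.toFinset)
      hy (f := fun k => Instr.compute (.root k) ::
      (interval (k + 1) y₁).flatMap fun i =>
        Instr.compute (.quot i k) ::
        (interval (k + 1) (i + 1)).map fun j => Instr.compute (.update i j k))
      (fun k => advance (lowerBox y₀ y₁ y₀ y₁) (fun c => min (c.2 + 1) k) P) ?_
    · refine (h.congr_left fun c _ _ => ?_).congr_right fun c _ _ => ?_
      · have e : c ∈ {c | c ∈ cells} ↔ c ∈ lowerBox y₀ y₁ y₀ y₁ := hmem c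
        simp only [advance, e, mem_lowerBox]
        split_ifs <;> omega
      · simp only [advance, mem_lowerBox]
        split_ifs <;> omega
    intro k hk1 hk2
    have h := Exec.flatMap_interval (S := S) (N := N) (L := L) (R := cells.toFinset)
      (D := cells.toFinset)
      (show k + 1 ≤ y₁ by omega) (f := fun i => Instr.compute (.quot i k) ::
        (interval (k + 1) (i + 1)).map fun j => Instr.compute (.update i j k))
      (fun i => advance (lowerBox y₀ y₁ y₀ y₁)
        (fun c => min (c.2 + 1) (if c.1 < i then k + 1 else k)) P) ?_
    · refine (Exec.cons ((Exec.compute (o := .root k) hL ?_ ?_ ?_).congr_right ?_) h).congr_right ?_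
      · simp only [Op.operands, Finset.singleton_subset_iff, List.mem_toFinset, hmem]
        omega
      · simp only [Op.target, List.mem_toFinset, hmem]
        omega
      · refine ⟨by omega, ?_⟩
        rw [advance_of_mem (by rw [mem_lowerBox]; dsimp only; omega)]
        simp
      · intro c h1 h2
        simp only [Function.update_apply, Op.target, Op.column, Prod.ext_iff, advance,
          mem_lowerBox]
        split_ifs <;> omega
      · intro c h1 h2
        simp only [advance, mem_lowerBox]
        split_ifs <;> omega
    intro i hi1 hi2
    have h := Exec.flatMap_interval (S := S) (N := N) (L := L) (R := cells.toFinset)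
      (D := cells.toFinset)
      (show k + 1 ≤ i + 1 by omega) (f := fun j => [Instr.compute (.update i j k)])
      -- Column `k` has been applied to the cells lexicographically before `(i, j)`; the minimum
      -- with `c.2 + 1` keeps finished cells unchanged. The loop over `j` starts at `k + 1`, which
      -- accounts for the division at `(i, k)`.
      (fun j => advance (lowerBox y₀ y₁ y₀ y₁)
        (fun c => min (c.2 + 1) (if c.1 < i ∨ c.1 = i ∧ c.2 < j then k + 1 else k)) P) ?_
    · rw [List.map_eq_flatMap]
      refine (Exec.cons ((Exec.compute (o := .quot i k) hL ?_ ?_ ?_).congr_right ?_) h).congr_right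
        ?_
      · intro c hc
        simp only [Op.operands, Finset.mem_insert, Finset.mem_singleton] at hc
        rw [List.mem_toFinset, hmem]
        rcases hc with rfl | rfl <;> dsimp only <;> omega
      · simp only [Op.target, List.mem_toFinset, hmem]
        omega
      · refine ⟨by omega, by omega, ?_, ?_⟩ <;>
        · rw [advance_of_mem (by rw [mem_lowerBox]; dsimp only; omega)]
          dsimp only
          split_ifs <;> omega
      · intro c h1 h2
        simp only [Function.update_apply, Op.target, Op.column, Prod.ext_iff, advance,
          mem_lowerBox]
        split_ifs <;> omega
      · intro c h1 h2
        simp only [advance, mem_lowerBox]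
        split_ifs <;> omega
    intro j hj1 hj2
    refine (Exec.compute (o := .update i j k) hL ?_ ?_ ?_).congr_right ?_
    · intro c hc
      simp only [Op.operands, Finset.mem_insert, Finset.mem_singleton] at hc
      rw [List.mem_toFinset, hmem]
      rcases hc with rfl | rfl | rfl <;> dsimp only <;> omega
    · simp only [Op.target, List.mem_toFinset, hmem]
      omega
    · refine ⟨by omega, by omega, by omega, ?_, ?_, ?_⟩ <;>
      · rw [advance_of_mem (by rw [mem_lowerBox]; dsimp only; omega)]
        dsimp only
        split_ifs <;> omega
    · intro c h1 h2
      simp only [Function.update_apply, Op.target, Op.column, Prod.ext_iff, advance,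
        mem_lowerBox]
      split_ifs <;> omega
  have := Exec.block hn (by omega) (h1.append h2)
  simpa only [OutOfCore.cholTile, List.append_assoc] using this

theorem Exec.oocChol {a n : ℕ} (hS : 3 ≤ S) (hL : ∀ k < N, 0 < L k k) (hN : a + n ≤ N)
    (hP : ∀ c ∈ lowerBox a (a + n) a (a + n), P c = a) :
    Exec S N L (oocChol S a n) ∅ ∅ P ∅ ∅
      (advance (lowerBox a (a + n) a (a + n)) (fun c => c.2 + 1) P) := by
  have h := Exec.flatMap_tiles (S := S) (N := N) (L := L) (R := ∅) (D := ∅) (tileSide_pos hS)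
    (show a ≤ a + n by omega)
    (f := fun J => OutOfCore.cholTile a J ++
      (tiles (tileSide S) J.2 (a + n)).flatMap fun I => OutOfCore.trsmTile a I J)
    (fun z => advance (lowerBox a (a + n) a z) (fun c => c.2 + 1) P) ?_
  · refine h.congr_left fun c _ _ => ?_
    rw [advance_of_notMem]
    rw [mem_lowerBox]
    omega
  intro y₀ y₁ hy0 hy1 hy2 hy3
  have h := Exec.flatMap_tiles (S := S) (N := N) (L := L) (R := ∅) (D := ∅) (tileSide_pos hS) hy2
    (f := fun I => OutOfCore.trsmTile a I (y₀, y₁))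
    (fun x => advance (lowerBox y₀ x y₀ y₁) (fun c => c.2 + 1)
      (advance (lowerBox a (a + n) a y₀) (fun c => c.2 + 1) P)) ?_
  · refine ((Exec.cholTile hL (tileSide_le S) hy1.le hy3 (by omega) hy0 ?_ ?_).append
      h).congr_right ?_
    · intro c hc
      rw [mem_lowerBox] at hc
      rw [advance_of_notMem (by rw [mem_lowerBox]; omega)]
      exact hP c (by rw [mem_lowerBox]; omega)
    · intro x k h1 h2 h3 h4
      rw [advance_of_mem (by rw [mem_lowerBox]; dsimp only; omega)]
      simp
    · intro c _ _
      simp only [advance, mem_lowerBox]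
      split_ifs <;> omega
  intro x₀ x₁ hx0 hx1 hx2 hx3
  refine (Exec.trsmTile hL (tileSide_le S) hx1.le (by omega) hx3 hy1.le hy3 hy0 hx0
    ?_ ?_ ?_).congr_right ?_
  · intro c hc
    rw [mem_lowerBox] at hc
    rw [advance_of_notMem (by rw [mem_lowerBox]; omega),
      advance_of_notMem (by rw [mem_lowerBox]; omega)]
    exact hP c (by rw [mem_lowerBox]; omega)
  · intro x k hx h1 h2
    rw [advance_of_notMem (by rw [mem_lowerBox]; dsimp only; omega),
      advance_of_mem (by rw [mem_lowerBox]; dsimp only; omega)]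
    simp
  · intro j k h1 h2 h3
    rw [advance_of_mem (by rw [mem_lowerBox]; dsimp only; omega)]
    simp
  · intro c _ _
    simp only [advance, mem_lowerBox]
    split_ifs <;> omega

end Blocks

/-! ### Triangle blocks -/

theorem two_le_triangleSide {S : ℕ} (hS : 3 ≤ S) : 2 ≤ triangleSide S :=
  Nat.le_findGreatest (by omega) (by omega)

theorem triangleSide_le (S : ℕ) : triangleSide S * (triangleSide S + 1) / 2 ≤ S :=
  Nat.findGreatest_spec (P := fun k => k * (k + 1) / 2 ≤ S) (Nat.zero_le S) (by simp)

theorem coprime_zoneSize {k n : ℕ} (h : zoneSize k n ≠ 0) :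
    Nat.Coprime (zoneSize k n) (primorial (k - 2)) :=
  Nat.findGreatest_of_ne_zero (P := fun c => Nat.Coprime c (primorial (k - 2))) rfl h

theorem zoneSize_mul_le (k n : ℕ) : zoneSize k n * k ≤ n :=
  (Nat.mul_le_mul_right k (Nat.findGreatest_le _)).trans (Nat.div_mul_le_self n k)

/-- A prime factor of `d ≤ m` is itself at most `m`, hence divides the primorial. -/
theorem coprime_of_primorial {c d m : ℕ} (h : Nat.Coprime c (primorial m)) (hd : 0 < d)
    (hdm : d ≤ m) : Nat.Coprime d c := by
  refine Nat.coprime_of_dvd fun p hp hpd hpc => ?_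
  have h1 : p ∣ primorial m :=
    hp.dvd_primorial_iff.2 ((Nat.le_of_dvd hd hpd).trans hdm)
  exact hp.one_lt.ne' (Nat.dvd_one.1 (h ▸ Nat.dvd_gcd hpc h1))

theorem cyclicIndex_lt {c i j u : ℕ} (hj : j < c) : cyclicIndex c i j u < c := by
  unfold cyclicIndex
  split_ifs
  · exact hj
  · exact Nat.mod_lt _ (by omega)

/-- Two rows in different zones determine the triangle block that contains both. -/
theorem cyclicIndex_injective {k c u v i j i' j' : ℕ} (hc : Nat.Coprime c (primorial (k - 2)))
    (hvu : v < u) (huk : u < k) (hi : i < c) (hj : j < c) (hi' : i' < c) (hj' : j' < c)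
    (h1 : cyclicIndex c i j u = cyclicIndex c i' j' u)
    (h2 : cyclicIndex c i j v = cyclicIndex c i' j' v) : i = i' ∧ j = j' := by
  have cast_inj : ∀ a b : ℕ, a < c → b < c → (a : ZMod c) = b → a = b := by
    intro a b ha hb hab
    rw [ZMod.natCast_eq_natCast_iff'] at hab
    rwa [Nat.mod_eq_of_lt ha, Nat.mod_eq_of_lt hb] at hab
  rw [cyclicIndex, cyclicIndex, if_neg (by omega), if_neg (by omega),
    ← ZMod.natCast_eq_natCast_iff'] at h1
  push_cast at h1
  have hjj : j = j' := by
    rcases Nat.eq_zero_or_pos v with rfl | hv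
    · simpa [cyclicIndex] using h2
    · rw [cyclicIndex, cyclicIndex, if_neg (by omega), if_neg (by omega),
        ← ZMod.natCast_eq_natCast_iff'] at h2
      push_cast at h2
      -- For `1 ≤ v < u ≤ k - 1` the difference `u - v` is between `1` and `k - 2`, exactly the
      -- range covered by the primorial. Subtracting the two congruences leaves `j * (u - v)`, and
      -- this unit can be cancelled.
      have hunit : IsUnit (((u - v : ℕ) : ZMod c)) :=
        (ZMod.isUnit_iff_coprime _ _).2 (coprime_of_primorial hc (by omega) (by omega))
      have e : ((u - 1 : ℕ) : ZMod c) = ((v - 1 : ℕ) : ZMod c) + ((u - v : ℕ) : ZMod c) := by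
        rw [← Nat.cast_add]
        congr 1
        omega
      rw [e] at h1
      refine cast_inj j j' hj hj' (hunit.mul_right_cancel ?_)
      linear_combination h1 - h2
  subst hjj
  exact ⟨cast_inj i i' hi hi' (by simpa using h1), rfl⟩

/-- An injective self-map of the finite set of pairs modulo `c` is surjective. -/
theorem exists_cyclicIndex {k c u v p q : ℕ} (hc : Nat.Coprime c (primorial (k - 2)))
    (hvu : v < u) (huk : u < k) (hp : p < c) (hq : q < c) :
    ∃ i < c, ∃ j < c, cyclicIndex c i j u = p ∧ cyclicIndex c i j v = q := by
  let f : Fin c × Fin c → Fin c × Fin c := fun x =>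
    (⟨cyclicIndex c x.1 x.2 u, cyclicIndex_lt x.2.2⟩,
      ⟨cyclicIndex c x.1 x.2 v, cyclicIndex_lt x.2.2⟩)
  have hf : Function.Injective f := by
    rintro ⟨i, j⟩ ⟨i', j'⟩ h
    simp only [f, Prod.mk.injEq, Fin.mk.injEq] at h
    have := cyclicIndex_injective hc hvu huk i.2 j.2 i'.2 j'.2 h.1 h.2
    exact Prod.ext (Fin.ext this.1) (Fin.ext this.2)
  obtain ⟨⟨i, j⟩, h⟩ := (Finite.injective_iff_surjective.1 hf) (⟨p, hp⟩, ⟨q, hq⟩)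
  simp only [f, Prod.mk.injEq, Fin.mk.injEq] at h
  exact ⟨i, i.2, j, j.2, h⟩

/-- The entries of the triangle block number `(i, j)`. -/
def triangleCells (k r c i j : ℕ) : List Cell :=
  (List.range k).flatMap fun u => (List.range u).map fun v =>
    (blockRow r c i j u, blockRow r c i j v)

theorem mem_triangleCells {k r c i j : ℕ} {d : Cell} : d ∈ triangleCells k r c i j ↔
    ∃ u v, v < u ∧ u < k ∧ d = (blockRow r c i j u, blockRow r c i j v) := by
  simp only [triangleCells, List.mem_flatMap, List.mem_range, List.mem_map]
  constructor
  · rintro ⟨u, hu, v, hv, rfl⟩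
    exact ⟨u, v, hv, hu, rfl⟩
  · rintro ⟨u, v, hv, hu, rfl⟩
    exact ⟨u, hu, v, hv, rfl⟩

theorem length_triangleCells (k r c i j : ℕ) :
    (triangleCells k r c i j).length * 2 + k = k * k := by
  induction k with
  | zero => simp [triangleCells]
  | succ k ih =>
    have : triangleCells (k + 1) r c i j = triangleCells k r c i j ++
        (List.range k).map fun v => (blockRow r c i j k, blockRow r c i j v) := by
      simp [triangleCells, List.range_succ]
    rw [this, List.length_append, List.length_map, List.length_range]
    linarith

section BlockRow

variable {r c i j : ℕ}

theorem le_blockRow (r c i j u : ℕ) : r + u * c ≤ blockRow r c i j u := by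
  unfold blockRow
  omega

theorem blockRow_lt (hj : j < c) (u : ℕ) : blockRow r c i j u < r + u * c + c := by
  have := cyclicIndex_lt (i := i) (u := u) hj
  unfold blockRow
  omega

theorem add_mul_le {u v : ℕ} (h : v < u) : v * c + c ≤ u * c := by
  have := Nat.mul_le_mul_right c (show v + 1 ≤ u from h)
  rwa [Nat.succ_mul] at this

theorem blockRow_strictMono (r i : ℕ) (hj : j < c) : StrictMono (blockRow r c i j) := by
  intro v u h
  have h1 := blockRow_lt (r := r) (i := i) hj v
  have h2 := le_blockRow r c i j u
  have h3 := add_mul_le (c := c) h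
  omega

theorem zone_unique {x u v : ℕ} (hu : r + u * c ≤ x) (hu' : x < r + u * c + c)
    (hv : r + v * c ≤ x) (hv' : x < r + v * c + c) : u = v := by
  rcases lt_trichotomy u v with h | h | h
  · have := add_mul_le (c := c) h
    omega
  · exact h
  · have := add_mul_le (c := c) h
    omega

theorem blockRow_eq_iff {i' j' u u' : ℕ} (hj : j < c) (hj' : j' < c) :
    blockRow r c i j u = blockRow r c i' j' u' ↔
      u = u' ∧ cyclicIndex c i j u = cyclicIndex c i' j' u' := by
  constructor
  · intro h
    have e : u = u' := zone_unique (le_blockRow r c i j u) (blockRow_lt hj u)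
      (h ▸ le_blockRow r c i' j' u') (h ▸ blockRow_lt hj' u')
    subst e
    refine ⟨rfl, ?_⟩
    unfold blockRow at h
    omega
  · rintro ⟨rfl, h⟩
    rw [blockRow, blockRow, h]

theorem nodup_triangleCells (k r i : ℕ) (hj : j < c) : (triangleCells k r c i j).Nodup := by
  have hinj := (blockRow_strictMono r i hj).injective
  rw [triangleCells, List.nodup_flatMap]
  refine ⟨fun u _ => List.nodup_range.map fun v w h => hinj (Prod.ext_iff.1 h).2, ?_⟩
  refine List.nodup_range.imp fun {u u'} h d hd hd' => h ?_
  simp only [List.mem_map] at hd hd'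
  obtain ⟨v, _, rfl⟩ := hd
  obtain ⟨v', _, e⟩ := hd'
  exact (hinj (Prod.ext_iff.1 e).1).symm

/-- The quotients of `x - r` and `y - r` by `c` are the two zones, the remainders the positions that
the block must hit; `exists_cyclicIndex` supplies its number. -/
theorem exists_mem_triangleCells {k x y : ℕ} (hc : Nat.Coprime c (primorial (k - 2)))
    (hc0 : 0 < c) (hy : r ≤ y) (hx : x < r + c * k) (hyx : (y - r) / c < (x - r) / c) :
    ∃ i < c, ∃ j < c, (x, y) ∈ triangleCells k r c i j := by
  have hrx : r ≤ x := by
    by_contra h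
    rw [Nat.sub_eq_zero_of_le (by omega : x ≤ r), Nat.zero_div] at hyx
    exact absurd hyx (Nat.not_lt_zero _)
  have huk : (x - r) / c < k := Nat.div_lt_of_lt_mul (by omega)
  obtain ⟨i, hi, j, hj, h1, h2⟩ := exists_cyclicIndex hc hyx huk (Nat.mod_lt (x - r) hc0)
    (Nat.mod_lt (y - r) hc0)
  refine ⟨i, hi, j, hj, mem_triangleCells.2 ⟨_, _, hyx, huk, ?_⟩⟩
  have e1 := Nat.div_add_mod' (x - r) c
  have e2 := Nat.div_add_mod' (y - r) c
  rw [blockRow, blockRow, h1, h2, Prod.mk.injEq]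
  omega

theorem disjoint_triangleCells {k i' j' : ℕ} (hc : Nat.Coprime c (primorial (k - 2)))
    (hi : i < c) (hj : j < c) (hi' : i' < c) (hj' : j' < c) (hne : (i, j) ≠ (i', j')) :
    Disjoint {d | d ∈ triangleCells k r c i j} {d | d ∈ triangleCells k r c i' j'} := by
  rw [Set.disjoint_left]
  intro d hd hd'
  obtain ⟨u, v, hvu, huk, rfl⟩ := mem_triangleCells.1 hd
  obtain ⟨u', v', -, -, e⟩ := mem_triangleCells.1 hd'
  rw [Prod.mk.injEq, blockRow_eq_iff hj hj', blockRow_eq_iff hj hj'] at e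
  obtain ⟨⟨rfl, e1⟩, rfl, e2⟩ := e
  obtain ⟨rfl, rfl⟩ := cyclicIndex_injective hc hvu huk hi hj hi' hj' e1 e2
  exact hne rfl

end BlockRow

theorem le_advance {T : Set Cell} {g P : Cell → ℕ} (h : ∀ c ∈ T, P c ≤ g c) (c : Cell) :
    P c ≤ advance T g P c := by
  by_cases hc : c ∈ T
  · rw [advance_of_mem hc]
    exact h c hc
  · rw [advance_of_notMem hc]

theorem flatMap_flatMap_eq_product {α β γ : Type*} (l : List α) (l' : List β)
    (f : α → β → List γ) :
    (l.flatMap fun a => l'.flatMap fun b => f a b) = (l ×ˢ l').flatMap fun x => f x.1 x.2 := by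
  simp only [SProd.sprod, List.product, List.flatMap_assoc, List.flatMap_map]

/-! ### Correctness of TBS and of the main loop. -/

section LBC

variable {S N : ℕ} {L : ℕ → ℕ → ℝ} {P : Cell → ℕ}

/-- The block and one column piece need `k (k - 1) / 2 + k = k (k + 1) / 2` places, which is the
quantity bounded by `S` in the choice of `k`. -/
theorem Exec.triangleBlock {r c i j n lo hi : ℕ} (hL : ∀ k < N, 0 < L k k)
    (hlh : lo ≤ hi) (hir : hi ≤ r) (hN : r + n ≤ N) (hj : j < c)
    (hcn : c * triangleSide S ≤ n)
    (hP : ∀ d ∈ triangleCells (triangleSide S) r c i j, P d = lo)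
    (hr : ∀ x k, r ≤ x → x < r + n → lo ≤ k → k < hi → k < P (x, k)) :
    Exec S N L (triangleBlock (triangleSide S) r c i j (interval lo hi)) ∅ ∅ P ∅ ∅
      (advance {d | d ∈ triangleCells (triangleSide S) r c i j} (fun _ => hi) P) := by
  have hlt : ∀ u < triangleSide S, blockRow r c i j u < r + n := fun u hu => by
    have h1 := blockRow_lt (r := r) (i := i) hj u
    have h2 := add_mul_le (c := c) hu
    rw [mul_comm c] at hcn
    omega
  have hge : ∀ u, r ≤ blockRow r c i j u := fun u => by
    have := le_blockRow r c i j u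
    omega
  refine Exec.syrkBlock (cells := triangleCells (triangleSide S) r c i j) hL hlh
    (nodup_triangleCells _ _ _ hj)
    (List.nodup_range.map (blockRow_strictMono r i hj).injective) ?_ ?_ ?_
  · rw [List.length_map, List.length_range]
    have h1 := length_triangleCells (triangleSide S) r c i j
    have h2 := triangleSide_le S
    rw [Nat.mul_add, mul_one] at h2
    omega
  · intro d hd
    have h0 := hP d hd
    obtain ⟨u, v, hvu, huk, rfl⟩ := mem_triangleCells.1 hd
    have h1 := hlt u huk
    have h2 := hge v
    have h3 := blockRow_strictMono r i hj hvu
    refine ⟨by dsimp only; omega, h3.le, by dsimp only; omega, ?_, ?_, h0⟩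
    · exact List.mem_map.2 ⟨u, List.mem_range.2 huk, rfl⟩
    · exact List.mem_map.2 ⟨v, List.mem_range.2 (hvu.trans huk), rfl⟩
  · intro x hx k h1 h2
    obtain ⟨u, hu, rfl⟩ := List.mem_map.1 hx
    exact hr _ k (hge u) (hlt u (List.mem_range.1 hu)) h1 h2

/-- The lower triangle splits into the last rows, the diagonal zones and the triangle blocks: a pair
of rows below `r + c * k` lies in one zone or in two different ones. The pieces are disjoint, so
each is found at progress `lo` when its turn comes; the columns that are read lie left of `C` and
stay final. -/
theorem Exec.tbs {r n lo hi : ℕ} (hS : 3 ≤ S) (hL : ∀ k < N, 0 < L k k) (hlh : lo ≤ hi)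
    (hir : hi ≤ r) (hN : r + n ≤ N) (hP : ∀ c ∈ lowerBox r (r + n) r (r + n), P c = lo)
    (hr : ∀ x k, r ≤ x → x < r + n → lo ≤ k → k < hi → k < P (x, k)) :
    Exec S N L (tbs S r n (interval lo hi)) ∅ ∅ P ∅ ∅
      (advance (lowerBox r (r + n) r (r + n)) (fun _ => hi) P) := by
  induction n using Nat.strong_induction_on generalizing r P with
  | _ n ih =>
  rw [OutOfCore.tbs]
  split_ifs with h
  · exact Exec.oocSyrk hS hL hlh hir le_rfl (by omega) hN hP hr
  have hcn := zoneSize_lt h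
  have hck := zoneSize_mul_le (triangleSide S) n
  have hk := two_le_triangleSide hS
  have hcop := coprime_zoneSize (k := triangleSide S) (n := n) (by omega)
  have hc0 : 0 < zoneSize (triangleSide S) n := by omega
  have htri := fun i j lo hi P hlh hir hj => Exec.triangleBlock (S := S) (N := N) (L := L) (P := P)
    (r := r) (c := zoneSize (triangleSide S) n) (i := i) (j := j) (n := n) (lo := lo) (hi := hi)
    hL hlh hir hN hj hck
  set k := triangleSide S
  set c := zoneSize k n
  have hzone : ∀ i < k, i * c + c ≤ c * k := fun i hi => by
    rw [mul_comm c]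
    exact add_mul_le hi
  have hbox : ∀ i < k, ∀ d ∈ lowerBox (r + i * c) (r + i * c + c) (r + i * c) (r + i * c + c),
      d ∈ lowerBox r (r + n) r (r + n) ∧ d ∉ lowerBox (r + c * k) (r + n) r (r + n) := by
    intro i hi d hd
    have := hzone i hi
    rw [mem_lowerBox] at hd ⊢
    rw [mem_lowerBox]
    omega
  have htriBox : ∀ i j, j < c → ∀ d ∈ triangleCells k r c i j,
      d ∈ lowerBox r (r + n) r (r + n) ∧ d ∉ lowerBox (r + c * k) (r + n) r (r + n) ∧
        ∀ i' < k, d ∉ lowerBox (r + i' * c) (r + i' * c + c) (r + i' * c) (r + i' * c + c) := by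
    intro i j hj d hd
    obtain ⟨u, v, hvu, huk, rfl⟩ := mem_triangleCells.1 hd
    have h1 := hzone u huk
    have h2 := blockRow_lt (r := r) (i := i) hj u
    have h3 := le_blockRow r c i j v
    have h4 := blockRow_strictMono r i hj hvu
    refine ⟨?_, ?_, ?_⟩
    · rw [mem_lowerBox]
      dsimp only
      omega
    · rw [mem_lowerBox]
      dsimp only
      omega
    · intro i' _ hd'
      rw [mem_lowerBox] at hd'
      have e1 := zone_unique (le_blockRow r c i j u) h2 hd'.1.1 hd'.1.2
      have e2 := zone_unique h3 (blockRow_lt (r := r) (i := i) hj v) hd'.2.1.1 hd'.2.1.2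
      omega
  have h1 : Exec S N L (OutOfCore.oocSyrk S r (r + c * k) n (interval lo hi)) ∅ ∅ P ∅ ∅
      (advance (lowerBox (r + c * k) (r + n) r (r + n)) (fun _ => hi) P) := by
    refine Exec.oocSyrk hS hL hlh hir (by omega) (by omega) hN (fun d hd => hP d ?_) hr
    rw [mem_lowerBox] at hd ⊢
    omega
  set P₁ := advance (lowerBox (r + c * k) (r + n) r (r + n)) (fun _ => hi) P with hP₁
  have hle₁ : ∀ d, P d ≤ P₁ d := le_advance fun d hd => by
    rw [hP d (by rw [mem_lowerBox] at hd ⊢; omega)]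
    exact hlh
  have h2 := Exec.sweep (S := S) (N := N) (L := L) (R := ∅) (D := ∅) (P := P₁) (l := List.range k)
    (T := fun i => lowerBox (r + i * c) (r + i * c + c) (r + i * c) (r + i * c + c))
    (g := fun _ => hi) (f := fun i => OutOfCore.tbs S (r + i * c) c (interval lo hi)) ?_ ?_ ?_
  rotate_left
  · refine List.nodup_range.imp fun {i i'} hne => Set.disjoint_left.2 fun d hd hd' => hne ?_
    rw [mem_lowerBox] at hd hd'
    exact zone_unique hd.1.1 hd.1.2 hd'.1.1 hd'.1.2
  · intro i hi d hd
    have := hbox i (List.mem_range.1 hi) d hd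
    rw [hP₁, advance_of_notMem this.2, hP d this.1]
    exact hlh
  · intro i hi Q hQ hQ'
    have hz := hzone i (List.mem_range.1 hi)
    refine ih c hcn (by omega) (by omega) (fun d hd => ?_) fun x m h1 h2 h3 h4 => ?_
    · have := hbox i (List.mem_range.1 hi) d hd
      rw [hQ' d hd, hP₁, advance_of_notMem this.2, hP d this.1]
    · exact ((hr x m (by omega) (by omega) h3 h4).trans_le (hle₁ _)).trans_le (hQ _)
  set T₂ : Set Cell := {d | ∃ i ∈ List.range k,
    d ∈ lowerBox (r + i * c) (r + i * c + c) (r + i * c) (r + i * c + c)} with hT₂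
  set P₂ := advance T₂ (fun _ => hi) P₁ with hP₂
  have hle₂ : ∀ d, P₁ d ≤ P₂ d := le_advance fun d hd => by
    obtain ⟨i, hi, hd⟩ := hd
    have := hbox i (List.mem_range.1 hi) d hd
    rw [hP₁, advance_of_notMem this.2, hP d this.1]
    exact hlh
  have htriP : ∀ i j, j < c → ∀ d ∈ triangleCells k r c i j, P₂ d = lo := by
    intro i j hj d hd
    obtain ⟨e1, e2, e3⟩ := htriBox i j hj d hd
    rw [hP₂, advance_of_notMem, hP₁, advance_of_notMem e2, hP d e1]
    rintro ⟨i', hi', h⟩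
    exact e3 i' (List.mem_range.1 hi') h
  have h3 := Exec.sweep (S := S) (N := N) (L := L) (R := ∅) (D := ∅) (P := P₂)
    (l := List.range c ×ˢ List.range c) (T := fun x => {d | d ∈ triangleCells k r c x.1 x.2})
    (g := fun _ => hi) (f := fun x => OutOfCore.triangleBlock k r c x.1 x.2 (interval lo hi))
    ?_ ?_ ?_
  rotate_left
  · refine List.Pairwise.imp_of_mem ?_ (List.nodup_range.product List.nodup_range)
    rintro ⟨i, j⟩ ⟨i', j'⟩ hx hx' hne
    rw [mem_product_iff, List.mem_range, List.mem_range] at hx hx'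
    exact disjoint_triangleCells hcop hx.1 hx.2 hx'.1 hx'.2 hne
  · rintro ⟨i, j⟩ hx d hd
    rw [mem_product_iff, List.mem_range, List.mem_range] at hx
    rw [htriP i j hx.2 d hd]
    exact hlh
  · rintro ⟨i, j⟩ hx Q hQ hQ'
    rw [mem_product_iff, List.mem_range, List.mem_range] at hx
    refine htri i j lo hi Q hlh hir hx.2 (fun d hd => ?_) fun x m h1 h2 h3 h4 => ?_
    · rw [hQ' d hd, htriP i j hx.2 d hd]
    · exact (((hr x m h1 h2 h3 h4).trans_le (hle₁ _)).trans_le (hle₂ _)).trans_le (hQ _)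
  rw [flatMap_flatMap_eq_product]
  refine ((h1.append h2).append h3).congr_right ?_
  rintro ⟨x, y⟩ hyx _
  dsimp only at hyx
  have e : (x, y) ∈ lowerBox r (r + n) r (r + n) ↔
      (x, y) ∈ lowerBox (r + c * k) (r + n) r (r + n) ∨ (x, y) ∈ T₂ ∨
        (x, y) ∈ {d | ∃ z ∈ List.range c ×ˢ List.range c,
          d ∈ {d | d ∈ triangleCells k r c z.1 z.2}} := by
    constructor
    · intro hb
      rw [mem_lowerBox] at hb
      dsimp only at hb
      by_cases hx : r + c * k ≤ x
      · left
        rw [mem_lowerBox]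
        dsimp only
        omega
      right
      rcases (Nat.div_le_div_right (c := c) (show y - r ≤ x - r by omega)).eq_or_lt with he | hlt
      · left
        have e1 := Nat.div_add_mod' (x - r) c
        have e2 := Nat.div_add_mod' (y - r) c
        have e3 := Nat.mod_lt (x - r) hc0
        have e4 := Nat.mod_lt (y - r) hc0
        rw [he] at e2
        refine ⟨(x - r) / c, List.mem_range.2 (Nat.div_lt_of_lt_mul (by omega)), ?_⟩
        rw [mem_lowerBox]
        dsimp only
        omega
      · right
        obtain ⟨i, hi, j, hj, h⟩ := exists_mem_triangleCells hcop hc0 hb.2.1.1 (by omega) hlt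
        exact ⟨(i, j), mem_product_iff.2 ⟨List.mem_range.2 hi, List.mem_range.2 hj⟩, h⟩
    · rintro (hb | ⟨i, hi, hb⟩ | ⟨z, hz, hb⟩)
      · rw [mem_lowerBox] at hb ⊢
        dsimp only at hb ⊢
        omega
      · exact (hbox i (List.mem_range.1 hi) _ hb).1
      · rw [mem_product_iff, List.mem_range, List.mem_range] at hz
        exact (htriBox z.1 z.2 hz.2 _ hb).1
  simp only [hP₂, hP₁, advance, e]
  split_ifs <;> tauto

/-- Right-looking invariant: after `i` passes every cell has received all its operations with
columns below `i * b`. The alternative `N = 0` is needed because then `Nat.sqrt N = 0`. -/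
theorem Exec.lbc {b : ℕ} (hS : 3 ≤ S) (hL : ∀ k < N, 0 < L k k) (hb : 0 < b ∨ N = 0) :
    Exec S N L (lbc S N b) ∅ ∅ (fun _ => 0) ∅ ∅ (fun c => c.2 + 1) := by
  have h := Exec.flatMap_range (S := S) (N := N) (L := L) (R := ∅) (D := ∅) (n := N / b + 1)
    (f := fun i => OutOfCore.oocChol S (i * b) (min ((i + 1) * b) N - i * b) ++
      if min ((i + 1) * b) N < N then
        OutOfCore.oocTrsm S (i * b) (min ((i + 1) * b) N - i * b) (min ((i + 1) * b) N) N ++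
        OutOfCore.tbs S (min ((i + 1) * b) N) (N - min ((i + 1) * b) N)
          (interval (i * b) (min ((i + 1) * b) N))
      else [])
    (fun i c => min (c.2 + 1) (min (i * b) N)) ?_
  · refine (h.congr_left fun c _ _ => by simp).congr_right fun c h1 h2 => ?_
    -- The passes reach past the last column, so the cap in the invariant is `N` and every cell is
    -- complete.
    have : N ≤ (N / b + 1) * b := by
      rcases hb with hb | rfl
      · exact (Nat.lt_div_mul_add hb).le.trans (by rw [Nat.succ_mul])
      · simp
    omega
  intro i hi
  have hlo : i * b ≤ N := (Nat.mul_le_mul_right b (Nat.lt_succ_iff.1 hi)).trans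
    (Nat.div_mul_le_self N b)
  have hstep : (i + 1) * b = i * b + b := Nat.succ_mul i b
  set lo := i * b
  rw [hstep]
  obtain ⟨hi, hhi⟩ : ∃ hi, hi = min (lo + b) N := ⟨_, rfl⟩
  rw [← hhi]
  have e1 : lo + (hi - lo) = hi := by omega
  have h1 : Exec S N L (OutOfCore.oocChol S lo (hi - lo)) ∅ ∅ (fun c => min (c.2 + 1) (min lo N))
      ∅ ∅ (advance (lowerBox lo hi lo hi) (fun c => c.2 + 1)
        fun c => min (c.2 + 1) (min lo N)) := by
    have := Exec.oocChol (S := S) (N := N) (L := L) (a := lo) (n := hi - lo)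
      (P := fun c => min (c.2 + 1) (min lo N)) hS hL (by omega) (fun c hc => by
        rw [mem_lowerBox] at hc
        omega)
    rwa [e1] at this
  split_ifs with hN
  · have h2 := Exec.oocTrsm (S := S) (N := N) (L := L) (a := lo) (n := hi - lo) (p := hi) (q := N)
      (P := advance (lowerBox lo hi lo hi) (fun c => c.2 + 1)
        fun c => min (c.2 + 1) (min lo N)) hS hL (by omega) hN.le le_rfl ?_ ?_
    rotate_left
    · intro c hc
      rw [mem_lowerBox] at hc
      rw [advance_of_notMem (by rw [mem_lowerBox]; omega)]
      omega
    · intro j k h1 h2 h3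
      rw [advance_of_mem (by rw [mem_lowerBox]; dsimp only; omega)]
      simp
    rw [e1] at h2
    have e2 : hi + (N - hi) = N := by omega
    have h3 := Exec.tbs (S := S) (N := N) (L := L) (r := hi) (n := N - hi) (lo := lo) (hi := hi)
      (P := advance (lowerBox hi N lo hi) (fun c => c.2 + 1)
        (advance (lowerBox lo hi lo hi) (fun c => c.2 + 1)
          fun c => min (c.2 + 1) (min lo N))) hS hL (by omega) le_rfl (by omega) ?_ ?_
    rotate_left
    · intro c hc
      rw [mem_lowerBox] at hc
      rw [advance_of_notMem (by rw [mem_lowerBox]; omega),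
        advance_of_notMem (by rw [mem_lowerBox]; omega)]
      omega
    · intro x k h1 h2 h3 h4
      rw [advance_of_mem (by rw [mem_lowerBox]; dsimp only; omega)]
      simp
    rw [e2] at h3
    refine (h1.append (h2.append h3)).congr_right fun c _ _ => ?_
    simp only [advance, mem_lowerBox]
    split_ifs <;> omega
  · rw [List.append_nil]
    refine h1.congr_right fun c _ _ => ?_
    simp only [advance, mem_lowerBox]
    split_ifs <;> omega

end LBC

/-- The factor is extended by zero to indices in `ℕ`. Progress `0` describes the input since the
terms `l > j` of `∑ l, L i l * L j l` vanish, and full progress leaves the factor itself in slow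
memory. -/
theorem run_lbc {S N : ℕ} (hS : 3 ≤ S) {A : Matrix (Fin N) (Fin N) ℝ} (hA : A.PosDef) :
    ∃ m : Memory, run S (lbc S N (Nat.sqrt N)) (initial A) = some m ∧
      A = lowerPart N m * (lowerPart N m).transpose := by
  obtain ⟨M, hM0, hM1, hM2⟩ := exists_cholesky hA
  let L : ℕ → ℕ → ℝ := fun i j => if h : i < N ∧ j < N then M ⟨i, h.1⟩ ⟨j, h.2⟩ else 0
  have hLM : ∀ i j : Fin N, L i j = M i j := fun i j => by simp [L]
  have hL0 : ∀ i j, i < j → L i j = 0 := by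
    intro i j hij
    by_cases h : i < N ∧ j < N
    · simpa [L, h] using hM0 ⟨i, h.1⟩ ⟨j, h.2⟩ hij
    · simp [L, h]
  have hL : ∀ k < N, 0 < L k k := fun k hk => by simpa [L, hk] using hM1 ⟨k, hk⟩
  have hb : 0 < Nat.sqrt N ∨ N = 0 := by
    rcases Nat.eq_zero_or_pos N with h | h
    · exact Or.inr h
    · exact Or.inl (Nat.sqrt_pos.2 h)
  have ht0 : Tracks N L ∅ ∅ (fun _ => 0) (initial A) := by
    refine ⟨rfl, ?_, by simp⟩
    rintro ⟨i, j⟩ _ hji hiN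
    dsimp only at hji hiN
    have hjN : j < N := by omega
    have e1 : (initial A).slow (i, j) = A ⟨i, hiN⟩ ⟨j, hjN⟩ := by simp [initial, hiN, hjN]
    have e2 : A ⟨i, hiN⟩ ⟨j, hjN⟩ = ∑ l : Fin N, L i l * L j l := by
      conv_lhs => rw [hM2]
      rw [Matrix.mul_apply]
      refine Finset.sum_congr rfl fun l _ => ?_
      rw [Matrix.transpose_apply, ← hLM, ← hLM]
    rw [e1, e2, Fin.sum_univ_eq_sum_range (fun l => L i l * L j l), partialValue,
      if_neg (by simp), Nat.Ico_zero_eq_range]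
    refine (Finset.sum_subset (by simpa using hjN) fun l _ hl => ?_).symm
    rw [hL0 j l (by simpa using hl), mul_zero]
  obtain ⟨m, hm, ht⟩ := Exec.lbc hS hL hb (initial A) ht0
  refine ⟨m, hm, ?_⟩
  have e : lowerPart N m = M := by
    ext i j
    rw [lowerPart, Matrix.of_apply]
    split_ifs with h
    · rw [ht.slow (i, j) (by simp) h i.2, partialValue_of_lt (by simp), hLM]
    · exact (hM0 i j (not_le.1 h)).symm
  rw [e, ← hM2]

/-! ### Counting transfers -/

theorem transfers_append (p q : Program) : transfers (p ++ q) = transfers p + transfers q := by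
  simp [transfers]

theorem transfers_nil : transfers [] = 0 := rfl

theorem transfers_loads (cs : List Cell) : transfers (loads cs) = cs.length := by
  simp [transfers, loads, Function.comp_def, Instr.transfers]

theorem transfers_evicts (cs : List Cell) : transfers (evicts cs) = 0 := by
  simp [transfers, evicts, Function.comp_def, Instr.transfers]

theorem transfers_flush (cs : List Cell) : transfers (flush cs) = cs.length := by
  rw [flush, transfers_append, transfers_evicts]
  simp [transfers, Function.comp_def, Instr.transfers]

theorem transfers_computes {ι : Type*} (l : List ι) (o : ι → Op) :
    transfers (l.map fun x => Instr.compute (o x)) = 0 := by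
  simp [transfers, Function.comp_def, Instr.transfers]

theorem transfers_flatMap_le {ι : Type*} {l : List ι} {f : ι → Program} {B : ℕ}
    (h : ∀ x ∈ l, transfers (f x) ≤ B) : transfers (l.flatMap f) ≤ l.length * B := by
  induction l with
  | nil => simp [transfers]
  | cons x l ih =>
    rw [List.flatMap_cons, transfers_append, List.length_cons, Nat.succ_mul]
    have h1 := h x (by simp)
    have h2 := ih fun y hy => h y (by simp [hy])
    omega

theorem transfers_flatMap_eq {ι : Type*} {l : List ι} {f : ι → Program} {B : ℕ}
    (h : ∀ x ∈ l, transfers (f x) = B) : transfers (l.flatMap f) = l.length * B := by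
  induction l with
  | nil => simp [transfers]
  | cons x l ih =>
    rw [List.flatMap_cons, transfers_append, List.length_cons, Nat.succ_mul, h x (by simp),
      ih fun y hy => h y (by simp [hy]), add_comm]

theorem transfers_accumulate (cells : List Cell) (rows cols : List ℕ) :
    transfers (accumulate cells rows cols) = cols.length * rows.length := by
  refine transfers_flatMap_eq fun k _ => ?_
  rw [transfers_append, transfers_append, transfers_loads, transfers_evicts, transfers_computes,
    List.length_map, add_zero, add_zero]

theorem transfers_syrkBlock (cells : List Cell) (rows cols : List ℕ) :
    transfers (syrkBlock cells rows cols) = 2 * cells.length + cols.length * rows.length := by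
  rw [syrkBlock, transfers_append, transfers_append, transfers_loads, transfers_flush,
    transfers_accumulate]
  ring

theorem bounds_of_mem_tiles {t a b : ℕ} (ht : 0 < t) {x : ℕ × ℕ} (hx : x ∈ tiles t a b) :
    a ≤ x.1 ∧ x.1 < x.2 ∧ x.2 ≤ b ∧ x.2 ≤ x.1 + t := by
  simp only [tiles, List.mem_map, List.mem_range] at hx
  obtain ⟨s, hs, rfl⟩ := hx
  have h1 := (Nat.lt_div_iff_mul_lt ht).1 hs
  have h2 : (s + 1) * t = s * t + t := Nat.succ_mul s t
  dsimp only
  omega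

theorem length_tiles_le {t : ℕ} (ht : 0 < t) (a b : ℕ) : (tiles t a b).length ≤ b - a := by
  rw [tiles, List.length_map, List.length_range, ← Nat.lt_succ_iff]
  refine Nat.div_lt_of_lt_mul ?_
  have : b - a ≤ t * (b - a) := Nat.le_mul_of_pos_left _ ht
  rw [Nat.mul_succ]
  omega

/-- Deliberately crude: the number of tiles is bounded by the number of rows or columns, giving away
a factor of the tile side each time. This is enough, since TBS leaves only boundedly many rows to
it. -/
theorem transfers_oocSyrk_le {S r p n : ℕ} (hS : 3 ≤ S) (hp : r ≤ p) (cols : List ℕ) :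
    transfers (oocSyrk S r p n cols) ≤ (r + n - p) * (n * (2 * S * (cols.length + 1))) := by
  have ht := tileSide_pos hS
  have hle := tileSide_le S
  refine (transfers_flatMap_le (B := n * (2 * S * (cols.length + 1))) fun I hI => ?_).trans
    (Nat.mul_le_mul_right _ (length_tiles_le ht _ _))
  have hI := bounds_of_mem_tiles ht hI
  refine (transfers_flatMap_le (B := 2 * S * (cols.length + 1)) fun J hJ => ?_).trans
    (Nat.mul_le_mul_right _ ((length_tiles_le ht _ _).trans (by omega)))
  have hJ := bounds_of_mem_tiles ht hJ
  rw [transfers_syrkBlock]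
  have h1 := List.length_filter_le (fun c : Cell => decide (c.2 ≤ c.1))
    ((interval I.1 I.2) ×ˢ (interval J.1 J.2))
  have h2 := List.length_filter_le (fun x => decide (J.2 ≤ x)) (interval I.1 I.2)
  rw [List.length_product, length_interval, length_interval] at h1
  rw [length_interval] at h2
  rw [List.length_append, length_interval]
  have h3 : (I.2 - I.1) * (J.2 - J.1) ≤ tileSide S * tileSide S :=
    Nat.mul_le_mul (by omega) (by omega)
  calc _ ≤ 2 * S + cols.length * S :=
        add_le_add (by omega) (Nat.mul_le_mul_left _ (by omega))
    _ ≤ 2 * S * (cols.length + 1) := by nlinarith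

theorem transfers_trsmTile_le {S a t : ℕ} {I J : ℕ × ℕ} (ht : t * t + 2 * t ≤ S)
    (hI : I.2 ≤ I.1 + t) (hJ : J.2 ≤ J.1 + t) :
    transfers (trsmTile a I J) ≤ 3 * S * (J.1 - a + 1) := by
  simp only [trsmTile]
  rw [transfers_append, transfers_append, transfers_append, transfers_loads, transfers_flush,
    transfers_accumulate, List.length_product, List.length_append, length_interval,
    length_interval, length_interval]
  have h1 : (I.2 - I.1) * (J.2 - J.1) ≤ t * t := Nat.mul_le_mul (by omega) (by omega)
  have h2 := transfers_flatMap_le (l := interval J.1 J.2) (B := t) (f := fun k =>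
    loads ((interval k J.2).map fun j => (j, k)) ++
    ((interval I.1 I.2).map fun i => Instr.compute (.quot i k)) ++
    (((interval I.1 I.2) ×ˢ interval (k + 1) J.2).map fun c =>
      Instr.compute (.update c.1 c.2 k)) ++
    evicts ((interval k J.2).map fun j => (j, k))) fun k hk => by
      rw [mem_interval] at hk
      rw [transfers_append, transfers_append, transfers_append, transfers_loads, transfers_evicts,
        transfers_computes, transfers_computes, List.length_map, length_interval]
      omega
  rw [length_interval] at h2
  have h3 : (J.2 - J.1) * t ≤ t * t := Nat.mul_le_mul_right _ (by omega)
  have h4 : (J.1 - a) * (I.2 - I.1 + (J.2 - J.1)) ≤ (J.1 - a) * S :=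
    Nat.mul_le_mul_left _ (by omega)
  have h5 : 3 * S * (J.1 - a + 1) = 3 * ((J.1 - a) * S) + 3 * S := by ring
  omega

theorem transfers_cholTile_le {S a t : ℕ} {J : ℕ × ℕ} (ht : t * t + 2 * t ≤ S)
    (hJ : J.2 ≤ J.1 + t) : transfers (cholTile a J) ≤ 3 * S * (J.1 - a + 1) := by
  simp only [cholTile]
  rw [transfers_append, transfers_append, transfers_append, transfers_loads, transfers_flush,
    transfers_accumulate, length_interval, length_interval]
  have h1 := List.length_filter_le (fun c : Cell => decide (c.2 ≤ c.1))
    ((interval J.1 J.2) ×ˢ (interval J.1 J.2))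
  rw [List.length_product, length_interval] at h1
  have h2 : (J.2 - J.1) * (J.2 - J.1) ≤ t * t := Nat.mul_le_mul (by omega) (by omega)
  have h3 : transfers ((interval J.1 J.2).flatMap fun k => Instr.compute (.root k) ::
      (interval (k + 1) J.2).flatMap fun i => Instr.compute (.quot i k) ::
        (interval (k + 1) (i + 1)).map fun j => Instr.compute (.update i j k)) = 0 := by
    have cons : ∀ (o : Op) (p : Program), transfers (Instr.compute o :: p) = transfers p := by
      intro o p
      simp [transfers, Instr.transfers]
    rw [transfers_flatMap_eq (B := 0), mul_zero]
    intro k _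
    rw [cons, transfers_flatMap_eq (B := 0), mul_zero]
    intro i _
    rw [cons, transfers_computes]
  have h4 : (J.1 - a) * (J.2 - J.1) ≤ (J.1 - a) * S := Nat.mul_le_mul_left _ (by omega)
  have h5 : 3 * S * (J.1 - a + 1) = 3 * ((J.1 - a) * S) + 3 * S := by ring
  refine (add_le_add (add_le_add (add_le_add h1 h4) h3.le) h1).trans ?_
  omega

theorem transfers_oocTrsm_le {S : ℕ} (hS : 3 ≤ S) (a n p q : ℕ) :
    transfers (oocTrsm S a n p q) ≤ (q - p) * (n * (3 * S * (n + 1))) := by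
  have ht := tileSide_pos hS
  refine (transfers_flatMap_le (B := n * (3 * S * (n + 1))) fun I hI => ?_).trans
    (Nat.mul_le_mul_right _ (length_tiles_le ht _ _))
  have hI := bounds_of_mem_tiles ht hI
  refine (transfers_flatMap_le (B := 3 * S * (n + 1)) fun J hJ => ?_).trans
    (Nat.mul_le_mul_right _ ((length_tiles_le ht _ _).trans (by omega)))
  have hJ := bounds_of_mem_tiles ht hJ
  exact (transfers_trsmTile_le (tileSide_le S) hI.2.2.2 hJ.2.2.2).trans
    (Nat.mul_le_mul_left _ (by omega))

theorem transfers_oocChol_le {S : ℕ} (hS : 3 ≤ S) (a n : ℕ) :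
    transfers (oocChol S a n) ≤ n * ((n + 1) * (3 * S * (n + 1))) := by
  have ht := tileSide_pos hS
  refine (transfers_flatMap_le (B := (n + 1) * (3 * S * (n + 1))) fun J hJ => ?_).trans
    (Nat.mul_le_mul_right _ ((length_tiles_le ht _ _).trans (by omega)))
  have hJ := bounds_of_mem_tiles ht hJ
  rw [transfers_append, Nat.succ_mul, add_comm]
  refine add_le_add ?_ ((transfers_cholTile_le (tileSide_le S) hJ.2.2.2).trans
    (Nat.mul_le_mul_left _ (by omega)))
  refine (transfers_flatMap_le (B := 3 * S * (n + 1)) fun I hI => ?_).trans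
    (Nat.mul_le_mul_right _ ((length_tiles_le ht _ _).trans (by omega)))
  have hI := bounds_of_mem_tiles ht hI
  exact (transfers_trsmTile_le (tileSide_le S) hI.2.2.2 hJ.2.2.2).trans
    (Nat.mul_le_mul_left _ (by omega))

/-! ### Cost of TBS -/

/-- The rows that do not belong to a zone are boundedly many. -/
theorem le_zoneSize_mul_add {k : ℕ} (hk : 0 < k) (n : ℕ) :
    n ≤ zoneSize k n * k + primorial (k - 2) * k := by
  have hQ := primorial_pos (k - 2)
  set Q := primorial (k - 2)
  have h1 : n < (n / k + 1) * k := by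
    rw [Nat.succ_mul]
    exact Nat.lt_div_mul_add hk
  have h2 : n / k + 1 ≤ zoneSize k n + Q := by
    rcases Nat.eq_zero_or_pos (n / k) with h0 | h0
    · omega
    -- Every number congruent to `1` modulo `Q` is coprime to `Q`, and the largest one up to `n / k`
    -- misses it by less than `Q`.
    · have h3 : 1 + (n / k - 1) / Q * Q ≤ zoneSize k n := by
        refine Nat.le_findGreatest ?_ ?_
        · have := Nat.div_mul_le_self (n / k - 1) Q
          omega
        · exact (Nat.coprime_add_mul_right_left 1 Q _).2 (Nat.coprime_one_left Q)
      have h4 := Nat.lt_div_mul_add (a := n / k - 1) hQ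
      omega
  calc n ≤ (n / k + 1) * k := h1.le
    _ ≤ (zoneSize k n + Q) * k := Nat.mul_le_mul_right _ h2
    _ = _ := by ring

theorem transfers_triangleBlock (k r c i j : ℕ) (cols : List ℕ) :
    transfers (triangleBlock k r c i j cols) + k = k * k + cols.length * k := by
  have h := length_triangleCells k r c i j
  have e : transfers (triangleBlock k r c i j cols) =
      2 * (triangleCells k r c i j).length + cols.length * k := by
    rw [triangleBlock, transfers_syrkBlock, List.length_map, List.length_range]
    rfl
  omega

/-- A bound for the number of rows that TBS leaves to OOC_SYRK. -/
def residue (S : ℕ) : ℕ :=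
  primorial (triangleSide S - 2) * triangleSide S + triangleSide S * triangleSide S

/-- Each of the three terms is chosen to survive the recursion on its own: the main term, the rows
left to OOC_SYRK, and the transfers of `C`. The power `n * √n` is not sharp, but for `n ≤ N` and
`√N` columns it contributes only `O(N²)` per pass of LBC. -/
theorem transfers_tbs_le {S : ℕ} (hS : 3 ≤ S) (r n : ℕ) (cols : List ℕ) :
    (transfers (tbs S r n cols) : ℝ) ≤
      cols.length * (n : ℝ) ^ 2 / ((triangleSide S : ℝ) - 1) +
        8 * S * residue S * (cols.length + 1) * (n * √(n : ℝ)) + 2 * (n : ℝ) ^ 2 := by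
  have hk := two_le_triangleSide hS
  have hkR : (2 : ℝ) ≤ triangleSide S := by exact_mod_cast hk
  induction n using Nat.strong_induction_on generalizing r with
  | _ n ih =>
  have hres := le_zoneSize_mul_add (show 0 < triangleSide S by omega) n
  have hsyrk : ∀ p, r ≤ p → r + n - p ≤ residue S →
      (transfers (oocSyrk S r p n cols) : ℝ) ≤ 2 * S * residue S * (cols.length + 1) * n := by
    intro p hp hpn
    have h1 := (transfers_oocSyrk_le (n := n) hS hp cols).trans (Nat.mul_le_mul_right _ hpn)
    calc (transfers (oocSyrk S r p n cols) : ℝ) ≤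
          ((residue S * (n * (2 * S * (cols.length + 1))) : ℕ) : ℝ) := by exact_mod_cast h1
      _ = _ := by push_cast; ring
  have hn : (n : ℝ) ≤ n * √(n : ℝ) := by
    rcases Nat.eq_zero_or_pos n with rfl | h
    · simp
    · exact le_mul_of_one_le_right (by positivity)
        (Real.one_le_sqrt.2 (by exact_mod_cast h))
  have hD : (0 : ℝ) ≤ S * residue S * (cols.length + 1) := by positivity
  rw [OutOfCore.tbs]
  split_ifs with h
  · have hs := hsyrk r le_rfl (by
      have h1 : zoneSize (triangleSide S) n * triangleSide S ≤ triangleSide S * triangleSide S :=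
        Nat.mul_le_mul_right _ (by omega)
      unfold residue
      omega)
    have h1 : (0 : ℝ) ≤ cols.length * (n : ℝ) ^ 2 / ((triangleSide S : ℝ) - 1) :=
      div_nonneg (by positivity) (by linarith)
    have h2 := mul_le_mul_of_nonneg_left hn hD
    have h3 : (0 : ℝ) ≤ S * residue S * (cols.length + 1) * n := by positivity
    nlinarith [sq_nonneg (n : ℝ)]
  · have hcn := zoneSize_lt h
    have hck := zoneSize_mul_le (triangleSide S) n
    have hs := hsyrk (r + zoneSize (triangleSide S) n * triangleSide S) (by omega) (by
      unfold residue
      omega)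
    set k := triangleSide S
    set c := zoneSize k n
    set m := cols.length
    have hck' : (c : ℝ) * k ≤ n := by exact_mod_cast hck
    obtain ⟨T, hT⟩ : ∃ T : ℝ, T = m * (c : ℝ) ^ 2 / ((k : ℝ) - 1) +
        8 * S * residue S * (m + 1) * (c * √(c : ℝ)) + 2 * (c : ℝ) ^ 2 := ⟨_, rfl⟩
    have hrec : (transfers ((List.range k).flatMap fun i => tbs S (r + i * c) c cols) : ℝ) ≤
        k * T := by
      -- The counting lemma takes bounds in `ℕ`, so the real bound of the induction hypothesis is
      -- rounded down.
      have hB : ∀ i ∈ List.range k, transfers (tbs S (r + i * c) c cols) ≤ ⌊T⌋₊ := fun i _ =>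
        Nat.le_floor (hT ▸ ih c hcn (r + i * c))
      have h1 := transfers_flatMap_le hB
      rw [List.length_range] at h1
      have hT0 : 0 ≤ T := le_trans (Nat.cast_nonneg _) (hT ▸ ih c hcn r)
      calc _ ≤ ((k * ⌊T⌋₊ : ℕ) : ℝ) := by exact_mod_cast h1
        _ ≤ k * T := by
          push_cast
          exact mul_le_mul_of_nonneg_left (Nat.floor_le hT0) (by positivity)
    have hblocks : (transfers ((List.range c).flatMap fun i =>
        (List.range c).flatMap fun j => triangleBlock k r c i j cols) : ℝ) =
        c * (c * (k * k - k + m * k)) := by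
      have hB : ∀ i j, transfers (triangleBlock k r c i j cols) = k * k + m * k - k :=
        fun i j => by
          have : _ + k = k * k + m * k := transfers_triangleBlock k r c i j cols
          omega
      rw [transfers_flatMap_eq (B := c * (k * k + m * k - k)), List.length_range]
      · have : k ≤ k * k + m * k := (Nat.le_mul_self k).trans (Nat.le_add_right _ _)
        push_cast [Nat.cast_sub this]
        ring
      · intro i _
        rw [transfers_flatMap_eq fun j _ => hB i j, List.length_range]
    rw [transfers_append, transfers_append]
    push_cast
    rw [hblocks]
    have hsq : ((c : ℝ) * k) ^ 2 ≤ (n : ℝ) ^ 2 := pow_le_pow_left₀ (by positivity) hck' 2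
    -- Here the denominator `k - 1` is forced: `k / (k - 1) + k = k² / (k - 1)`, so the sum is the
    -- same expression at `c * k ≤ n`.
    have hmain : (k : ℝ) * (m * (c : ℝ) ^ 2 / ((k : ℝ) - 1)) + c * (c * (m * k)) ≤
        m * (n : ℝ) ^ 2 / ((k : ℝ) - 1) := by
      have hk1 : (0 : ℝ) < (k : ℝ) - 1 := by linarith
      have e : (k : ℝ) * (m * (c : ℝ) ^ 2 / ((k : ℝ) - 1)) + c * (c * (m * k)) =
          m * ((c : ℝ) * k) ^ 2 / ((k : ℝ) - 1) := by
        field_simp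
        ring
      rw [e]
      gcongr
    have hquad : (k : ℝ) * (2 * (c : ℝ) ^ 2) + c * (c * (k * k - k)) ≤ 2 * (n : ℝ) ^ 2 := by
      have h1 : 2 * ((k : ℝ) * (c : ℝ) ^ 2) ≤ k * (k * (c : ℝ) ^ 2) :=
        mul_le_mul_of_nonneg_right hkR (by positivity)
      have h2 : (0 : ℝ) ≤ k * (c : ℝ) ^ 2 := by positivity
      nlinarith
    -- From `c ≤ n / 2` and `1 / 2 ≤ (3 / 4)²` the recursive calls use at most three quarters of `n
    -- * √n`. The remaining quarter pays for OOC_SYRK, whose factor `2` is a quarter of the `8` in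
    -- the bound.
    have hmid : (n : ℝ) / 4 + k * (c * √(c : ℝ)) ≤ n * √(n : ℝ) := by
      have h1 : √(c : ℝ) ≤ 3 / 4 * √(n : ℝ) := by
        rw [Real.sqrt_le_left (by positivity), mul_pow, Real.sq_sqrt (by positivity)]
        have : (c : ℝ) * 2 ≤ c * k := mul_le_mul_of_nonneg_left hkR (by positivity)
        linarith
      have h2 : (c : ℝ) * k * √(c : ℝ) ≤ n * (3 / 4 * √(n : ℝ)) :=
        mul_le_mul hck' h1 (by positivity) (by positivity)
      linarith
    have hmid' := mul_le_mul_of_nonneg_left hmid (show (0 : ℝ) ≤ 8 * (S * residue S * (m + 1)) by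
      positivity)
    rw [hT] at hrec
    nlinarith

/-! ### Cost of LBC -/

/-- Potential argument: every pass is paid by the drop of `φ`, up to an error `B`, and the drops
telescope. -/
theorem transfers_flatMap_range_le {n : ℕ} {f : ℕ → Program} {φ : ℕ → ℝ} {B : ℝ}
    (h : ∀ i < n, (transfers (f i) : ℝ) ≤ φ i - φ (i + 1) + B) :
    (transfers ((List.range n).flatMap f) : ℝ) ≤ φ 0 - φ n + n * B := by
  induction n with
  | zero => simp [transfers]
  | succ n ih =>
    have h1 := ih fun i hi => h i (by omega)
    have h2 := h n (by omega)
    rw [List.range_succ, List.flatMap_append, transfers_append]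
    simp only [List.flatMap_cons, List.flatMap_nil, List.append_nil]
    push_cast
    linarith

/-- The block size balances two errors: moving the trailing matrix costs `O(N²)` in each of about `N
/ b` passes, while the crude bound for the panel is `O(N b²)` per pass. Both are `O(N²)` for `b ≈
√N`. -/
theorem transfers_lbc_le {S : ℕ} (hS : 3 ≤ S) : ∃ C : ℝ, ∀ N : ℕ,
    (transfers (lbc S N (Nat.sqrt N)) : ℝ) ≤
      1 / 3 * ((N : ℝ) ^ 3 / ((triangleSide S : ℝ) - 1)) + C * (N : ℝ) ^ (5 / 2 : ℝ) := by
  obtain ⟨D, hD⟩ : ∃ D : ℝ, D = 8 * S * residue S := ⟨_, rfl⟩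
  have hD0 : 0 ≤ D := by rw [hD]; positivity
  -- Error of one pass in units of `N²`: `12 S` for OOC_CHOL, `6 S` for OOC_TRSM and `2 D + 2` for
  -- TBS. The factor `4` in the final constant bounds the number of passes by `4 b`.
  obtain ⟨E, hE⟩ : ∃ E : ℝ, E = 18 * S + 2 * D + 2 := ⟨_, rfl⟩
  have hE0 : 0 ≤ E := by rw [hE]; positivity
  refine ⟨4 * E, fun N => ?_⟩
  have hkR : (2 : ℝ) ≤ triangleSide S := by exact_mod_cast two_le_triangleSide hS
  have hk1 : (0 : ℝ) < (triangleSide S : ℝ) - 1 := by linarith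
  rcases Nat.eq_zero_or_pos N with rfl | hN
  · have : transfers (lbc S 0 (Nat.sqrt 0)) = 0 := by
      have := transfers_oocChol_le hS 0 0
      simpa [lbc] using this
    rw [this]
    simp
  have hb0 : 0 < Nat.sqrt N := Nat.sqrt_pos.2 hN
  have hbb : Nat.sqrt N * Nat.sqrt N ≤ N := Nat.sqrt_le N
  have hbN : Nat.sqrt N ≤ N := Nat.sqrt_le_self N
  have hNb : N ≤ Nat.sqrt N * Nat.sqrt N + Nat.sqrt N + Nat.sqrt N := Nat.sqrt_le_add N
  have hbsqrt : ((Nat.sqrt N : ℕ) : ℝ) ≤ √(N : ℝ) := Real.nat_sqrt_le_real_sqrt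
  set b := Nat.sqrt N
  have hbR : (1 : ℝ) ≤ b := by exact_mod_cast hb0
  have hNR : (1 : ℝ) ≤ N := by exact_mod_cast hN
  have hbbR : (b : ℝ) * b ≤ N := by exact_mod_cast hbb
  have hss : √(N : ℝ) * √(N : ℝ) = N := Real.mul_self_sqrt (by positivity)
  have hchol : ∀ a n, n ≤ b → (transfers (oocChol S a n) : ℝ) ≤ 12 * S * (N : ℝ) ^ 2 := by
    intro a n hn
    have h1 : transfers (oocChol S a n) ≤ b * ((b + 1) * (3 * S * (b + 1))) :=
      (transfers_oocChol_le hS a n).trans (by gcongr)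
    have h2 : b * ((b + 1) * (3 * S * (b + 1))) ≤ 12 * S * N ^ 2 := by
      calc b * ((b + 1) * (3 * S * (b + 1))) ≤ b * ((2 * b) * (3 * S * (2 * b))) := by
            gcongr <;> omega
        _ = 12 * S * ((b * b) * b) := by ring
        _ ≤ 12 * S * (N * N) := by gcongr
        _ = 12 * S * N ^ 2 := by ring
    exact_mod_cast h1.trans h2
  have htrsm : ∀ a p, (transfers (oocTrsm S a b p N) : ℝ) ≤ 6 * S * (N : ℝ) ^ 2 := by
    intro a p
    have h1 : transfers (oocTrsm S a b p N) ≤ N * (b * (3 * S * (b + 1))) :=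
      (transfers_oocTrsm_le hS a b p N).trans (Nat.mul_le_mul_right _ (Nat.sub_le _ _))
    have h2 : N * (b * (3 * S * (b + 1))) ≤ 6 * S * N ^ 2 := by
      calc N * (b * (3 * S * (b + 1))) ≤ N * (b * (3 * S * (2 * b))) := by
            gcongr; omega
        _ = 6 * S * (N * (b * b)) := by ring
        _ ≤ 6 * S * (N * N) := by gcongr
        _ = 6 * S * N ^ 2 := by ring
    exact_mod_cast h1.trans h2
  have htbs : ∀ r n cols, n ≤ N → cols.length = b → (transfers (tbs S r n cols) : ℝ) ≤
      b * (n : ℝ) ^ 2 / ((triangleSide S : ℝ) - 1) + (2 * D + 2) * (N : ℝ) ^ 2 := by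
    intro r n cols hn hcols
    have h1 := transfers_tbs_le hS r n cols
    rw [hcols, ← hD] at h1
    have hnR : (n : ℝ) ≤ N := by exact_mod_cast hn
    have h2 : D * (b + 1) * (n * √(n : ℝ)) ≤ 2 * D * (N : ℝ) ^ 2 := by
      calc D * (b + 1) * (n * √(n : ℝ)) ≤ D * (2 * √(N : ℝ)) * (N * √(N : ℝ)) := by
            gcongr
            linarith
        _ = 2 * D * N * (√(N : ℝ) * √(N : ℝ)) := by ring
        _ = 2 * D * (N : ℝ) ^ 2 := by rw [hss]; ring
    have h3 : (n : ℝ) ^ 2 ≤ (N : ℝ) ^ 2 := by gcongr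
    linarith
  have hsum := transfers_flatMap_range_le (n := N / b + 1)
    -- The potential is the main term still to be paid for the rows not yet factored. Subtraction in
    -- `ℕ` makes it zero after a last, shorter block.
    (φ := fun i => ((N - i * b : ℕ) : ℝ) ^ 3 / 3 / ((triangleSide S : ℝ) - 1))
    (B := E * (N : ℝ) ^ 2)
    (f := fun i => oocChol S (i * b) (min ((i + 1) * b) N - i * b) ++
      if min ((i + 1) * b) N < N then
        oocTrsm S (i * b) (min ((i + 1) * b) N - i * b) (min ((i + 1) * b) N) N ++
        tbs S (min ((i + 1) * b) N) (N - min ((i + 1) * b) N)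
          (interval (i * b) (min ((i + 1) * b) N))
      else []) ?_
  · have hpass : ((N / b + 1 : ℕ) : ℝ) ≤ 4 * b := by
      -- From `N ≤ b² + 2 b` there are at most `b + 3` passes, and `b ≥ 1`.
      have : N / b < b + 3 := Nat.div_lt_of_lt_mul (by nlinarith)
      have h : N / b + 1 ≤ 4 * b := by omega
      exact_mod_cast h
    have hpow : (N : ℝ) ^ (5 / 2 : ℝ) = N ^ 2 * √(N : ℝ) := by
      rw [Real.sqrt_eq_rpow, ← Real.rpow_natCast, ← Real.rpow_add (by linarith)]
      norm_num
    have h1 : ((N / b + 1 : ℕ) : ℝ) * (E * (N : ℝ) ^ 2) ≤ 4 * √(N : ℝ) * (E * (N : ℝ) ^ 2) := by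
      gcongr
      linarith
    have h2 : (0 : ℝ) ≤ ((N - (N / b + 1) * b : ℕ) : ℝ) ^ 3 / 3 / ((triangleSide S : ℝ) - 1) := by
      positivity
    have h3 : ((N - 0 * b : ℕ) : ℝ) ^ 3 / 3 / ((triangleSide S : ℝ) - 1) =
        1 / 3 * ((N : ℝ) ^ 3 / ((triangleSide S : ℝ) - 1)) := by
      rw [zero_mul, Nat.sub_zero]
      ring
    rw [h3] at hsum
    rw [hpow]
    refine hsum.trans ?_
    linarith
  · intro i _
    have hstep : (i + 1) * b = i * b + b := Nat.succ_mul i b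
    rw [transfers_append]
    have hc := hchol (i * b) (min ((i + 1) * b) N - i * b) (by omega)
    push_cast
    split_ifs with h
    · have e1 : min ((i + 1) * b) N = (i + 1) * b := by omega
      rw [e1] at hc h ⊢
      have e2 : (i + 1) * b - i * b = b := by omega
      rw [e2] at hc ⊢
      have ht := htrsm (i * b) ((i + 1) * b)
      have hu := htbs ((i + 1) * b) (N - (i + 1) * b) (interval (i * b) ((i + 1) * b))
        (Nat.sub_le _ _) (by rw [length_interval, e2])
      rw [transfers_append]
      push_cast
      obtain ⟨u, hu'⟩ : ∃ u, u = N - (i + 1) * b := ⟨_, rfl⟩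
      have e3 : N - i * b = u + b := by omega
      rw [← hu'] at hu ⊢
      rw [e3, ← sub_div, ← sub_div]
      -- The expansion of `(u + b)³ - u³` contains `3 b u²`, and its other terms are nonnegative.
      have h4 : (b : ℝ) * (u : ℝ) ^ 2 / ((triangleSide S : ℝ) - 1) ≤
          (((u + b : ℕ) : ℝ) ^ 3 - (u : ℝ) ^ 3) / 3 / ((triangleSide S : ℝ) - 1) := by
        gcongr
        push_cast
        have : (0 : ℝ) ≤ (b : ℝ) ^ 3 := by positivity
        have : (0 : ℝ) ≤ (u : ℝ) * (b : ℝ) ^ 2 := by positivity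
        nlinarith
      rw [hE]
      linarith
    · have e1 : N - (i + 1) * b = 0 := by omega
      rw [e1, transfers_nil]
      have h1 : (0 : ℝ) ≤ ((N - i * b : ℕ) : ℝ) ^ 3 / 3 / ((triangleSide S : ℝ) - 1) := by
        positivity
      have h2 : 12 * S * (N : ℝ) ^ 2 ≤ E * (N : ℝ) ^ 2 := by
        gcongr
        rw [hE]
        have : (0 : ℝ) ≤ S := by positivity
        linarith
      simp only [Nat.cast_zero]
      rw [zero_pow (by norm_num), zero_div, zero_div]
      linarith

/-! ### From the triangle side to the square root of the memory size. -/

theorem two_mul_le_triangleSide {S : ℕ} (hS : 3 ≤ S) :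
    2 * S ≤ triangleSide S * triangleSide S + 3 * triangleSide S := by
  have hk := two_le_triangleSide hS
  have h1 := triangleSide_le S
  -- The search for the largest side stops at `S`, so its maximality can be applied to the next side
  -- only if that is still at most `S`.
  have hlt : triangleSide S < S := by
    have : triangleSide S * 3 ≤ triangleSide S * (triangleSide S + 1) :=
      Nat.mul_le_mul_left _ (by omega)
    omega
  have h2 : ¬ (triangleSide S + 1) * (triangleSide S + 1 + 1) / 2 ≤ S :=
    Nat.findGreatest_is_greatest (P := fun k => k * (k + 1) / 2 ≤ S) (Nat.lt_succ_self _) hlt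
  have e : (triangleSide S + 1) * (triangleSide S + 1 + 1) =
      triangleSide S * triangleSide S + 3 * triangleSide S + 2 := by ring
  omega

/-- For `k ≥ 3`, `2 S ≤ k² + 3 k` gives both `√(2 S) ≤ k + 3 / 2` and `√S ≤ 2 (k - 1)`. Hence `√2 S
≤ (k - 1) √S + (5 / 2) √S`, and the last term is at most `5 (k - 1)`, which is where the `5` comes
from. -/
theorem inv_triangleSide_le {S : ℕ} (hS : 3 ≤ S) :
    1 / ((triangleSide S : ℝ) - 1) ≤ 1 / √2 / √(S : ℝ) * (1 + 5 / √(S : ℝ)) := by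
  have hk := two_le_triangleSide hS
  have h2 := two_mul_le_triangleSide hS
  have hkR : (2 : ℝ) ≤ triangleSide S := by exact_mod_cast hk
  have h2R : 2 * (S : ℝ) ≤ triangleSide S * triangleSide S + 3 * triangleSide S := by
    exact_mod_cast h2
  have hs : 0 < √(S : ℝ) := Real.sqrt_pos.2 (by exact_mod_cast (by omega : 0 < S))
  have hss : √(S : ℝ) * √(S : ℝ) = S := Real.mul_self_sqrt (by positivity)
  have key : √2 * S ≤ ((triangleSide S : ℝ) - 1) * (√(S : ℝ) + 5) := by
    -- For `k = 2` the estimate `√S ≤ 2 (k - 1)` fails at `S = 5`, so `S = 3, 4, 5` are checked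
    -- numerically; at `S = 5` the claim `5 √2 ≤ √5 + 5` is tight enough to require the constants
    -- `1.43` and `2.8`.
    rcases hk.eq_or_lt with h | h
    · have hS5 : S ≤ 5 := by
        rw [← h] at h2
        omega
      rw [← h]
      have h3 : √(2 : ℝ) ≤ 143 / 100 := Real.sqrt_le_iff.2 (by norm_num)
      have h4 : (S : ℝ) - 2.8 ≤ √(S : ℝ) := by
        refine Real.le_sqrt_of_sq_le ?_
        interval_cases S <;> norm_num
      have h5 : (S : ℝ) ≤ 5 := by exact_mod_cast hS5
      have h6 : √2 * (S : ℝ) ≤ 143 / 100 * S := by gcongr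
      push_cast
      linarith
    · have h3R : (3 : ℝ) ≤ triangleSide S := by exact_mod_cast h
      have h3 : √2 * √(S : ℝ) ≤ triangleSide S + 3 / 2 := by
        refine abs_le_of_sq_le_sq' ?_ (by linarith) |>.2
        rw [mul_pow, Real.sq_sqrt (by norm_num), Real.sq_sqrt (by positivity)]
        nlinarith
      have h4 : √(S : ℝ) ≤ 2 * ((triangleSide S : ℝ) - 1) := by
        refine Real.sqrt_le_iff.2 ⟨by linarith, ?_⟩
        nlinarith
      have h5 := mul_le_mul_of_nonneg_right h3 hs.le
      have h6 : √2 * √(S : ℝ) * √(S : ℝ) = √2 * S := by rw [mul_assoc, hss]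
      nlinarith
  have e : 1 / √2 / √(S : ℝ) * (1 + 5 / √(S : ℝ)) = (√(S : ℝ) + 5) / (√2 * S) := by
    have h : √2 * (S : ℝ) = √2 * (√(S : ℝ) * √(S : ℝ)) := by rw [hss]
    rw [h]
    field_simp
  rw [e, div_le_div_iff₀ (by linarith) (by positivity)]
  linarith

end OutOfCore

theorem mainTheorem5 (S : ℕ) (hS : 3 ≤ S) :
    (∀ (N : ℕ) (A : Matrix (Fin N) (Fin N) ℝ), A.PosDef →
      ∃ m : OutOfCore.Memory,
        OutOfCore.run S (OutOfCore.lbc S N (Nat.sqrt N)) (OutOfCore.initial A) = some m ∧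
        A = OutOfCore.lowerPart N m * (OutOfCore.lowerPart N m).transpose) ∧
    ∃ C : ℝ, ∀ N : ℕ,
      (OutOfCore.transfers (OutOfCore.lbc S N (Nat.sqrt N)) : ℝ) ≤
          1 / 3 * ((N : ℝ) ^ 3 / ((OutOfCore.triangleSide S : ℝ) - 1)) +
            C * (N : ℝ) ^ (5 / 2 : ℝ) ∧
      (OutOfCore.transfers (OutOfCore.lbc S N (Nat.sqrt N)) : ℝ) ≤
          1 / (3 * √2) * ((N : ℝ) ^ 3 / √(S : ℝ)) * (1 + 5 / √(S : ℝ)) +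
            C * (N : ℝ) ^ (5 / 2 : ℝ) := by
  refine ⟨fun N A hA => OutOfCore.run_lbc hS hA, ?_⟩
  obtain ⟨C, hC⟩ := OutOfCore.transfers_lbc_le hS
  refine ⟨C, fun N => ⟨hC N, (hC N).trans (add_le_add_left ?_ _)⟩⟩
  have h := mul_le_mul_of_nonneg_left (OutOfCore.inv_triangleSide_le hS)
    (show (0 : ℝ) ≤ 1 / 3 * (N : ℝ) ^ 3 by positivity)
  calc _ = 1 / 3 * (N : ℝ) ^ 3 * (1 / ((OutOfCore.triangleSide S : ℝ) - 1)) := by ring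
    _ ≤ _ := h
    _ = _ := by field_simp
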